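/- Let $d\ge 2$ and let $\pi$ be a probability distribution on $\mathbb R^d$ with its Borel $\sigma$-algebra. Write $|\cdot|$ for the Euclidean norm, $x_{-k}$ for the vector $x$ without its $k$-th coordinate, and $(x_{-k},t)$ for $x$ with its $k$-th coordinate replaced by $t$. For each $k\in\{1,\dots,d\}$ fix a regular version $\pi(\cdot\mid x_{-k})$, $x_{-k}\in\mathbb R^{d-1}$, of the conditional distribution of $X_k$ given $X_{-k}=x_{-k}$, where $X\sim\pi$. Let $P_k(x,\cdot)$ be the law of $(x_{-k},Y)$ with $Y\sim\pi(\cdot\mid x_{-k})$, let $P_{\mathrm{RS}}=\frac1d\sum_{k=1}^d P_k$ be the random-scan Gibbs kernel, and put $\|\mu-\nu\|_{\mathrm{TV}}=\sup_S|\mu(S)-\nu(S)|$ over measurable $S$. For a $\pi$-invariant Markov kernel $P$ define the conductance $$\Phi(P)=\inf\Big\{\tfrac{1}{\pi(S)}\int_S P(x,S^c)\,\pi(dx):\ S\text{ measurable},\ 0<\pi(S)\le\tfrac12\Big\};$$ for a $\pi$-reversible $P$ the spectral gap $$\lambda_2(P)=\inf\Big\{\tfrac{\langle f,(I-P)f\rangle_{L^2(\pi)}}{\|f\|_{L^2(\pi)}^2}:\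 0\ne f\in L^2(\pi),\ \textstyle\int f\,d\pi=0\Big\};$$ and, for an initial distribution $\mu$ and $\zeta>0$, the mixing time $\tau(\zeta,P)=\inf\{n\ge0:\|\mu P^n-\pi\|_{\mathrm{TV}}\le\zeta\}$ (with $\inf\emptyset=+\infty$ throughout). The distribution $\mu$ is an $\Omega$-warm start if $\mu(S)\le\Omega\,\pi(S)$ for all measurable $S$. **Theorem.** There are universal constants $c_1,c_2,c_3>0$ such that the following holds for all $d\ge2$, $q\ge1$, $C>0$, $M>0$, $\beta\in(0,1]$ and all $\pi$ as above. Suppose that $\pi$ satisfies the $L^q$-Poincaré inequality with constant $C$, that is, $$\mathbb E_\pi\big[|f-\mathbb E_\pi f|^q\big]\le\frac1C\,\mathbb E_\pi\big[|\nabla f|^q\big]$$ for every locally Lipschitz $\pi$-integrable $f:\mathbb R^d\to\mathbb R$ whose gradient exists $\pi$-almost everywhere (the last condition is automatic if $\pi$ has a Lebesgue density), and that the conditional distributions of $\pi$ are $(M,\beta)$-TV continuous, that is, $$\|\pi(\cdot\mid x_{-k})-\pi(\cdot\mid y_{-k})\|_{\mathrm{TV}}\le M|x_{-k}-y_{-k}|^\beta\qquad\text{for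 all }k\text{ and all }x,y\in\mathbb R^d.$$ Let $N_d=\lceil 4d\log d\rceil$. Then $$\Phi\big(P_{\mathrm{RS}}^{N_d}\big)\ \ge\ c_1\min\Big\{1,\frac{C}{(MN_d)^{q/\beta}}\Big\},\qquad \lambda_2\big(P_{\mathrm{RS}}^{N_d}\big)\ \ge\ c_2\min\Big\{1,\frac{C^2}{(MN_d)^{2q/\beta}}\Big\},$$ and, for every $\Omega>0$, every initial probability distribution $\mu$ that is an $\Omega$-warm start, and every $0<\zeta\le\sqrt\Omega$, $$\tau\big(\zeta,P_{\mathrm{RS}}^{N_d}\big)\ \le\ c_3\max\Big\{1,\frac{(MN_d)^{2q/\beta}}{C^2}\Big\}\log\Big(\frac{\sqrt\Omega}{\zeta}\Big).$$ -/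

import Mathlib

open MeasureTheory ProbabilityTheory
open scoped ENNReal NNReal

namespace GibbsSampler

/-- Total variation distance of two probability measures:
`sup {|μ S - ν S| : S measurable}`. -/
noncomputable def tvDist {X : Type*} [MeasurableSpace X] (μ ν : Measure X) : ℝ :=
  ⨆ S : {S : Set X // MeasurableSet S}, |μ.real S.1 - ν.real S.1|

/-- The vector `x_{-k}` obtained from `x` by deleting the coordinate `k`. -/
noncomputable def dropCoord {d : ℕ} (k : Fin d) (x : EuclideanSpace ℝ (Fin d)) :
    EuclideanSpace ℝ {j : Fin d // j ≠ k} :=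
  WithLp.toLp 2 fun j => x j.1

/-- The vector `(x_{-k}, t)` obtained from `x` by replacing the coordinate `k` by `t`. -/
noncomputable def setCoord {d : ℕ} (k : Fin d) (x : EuclideanSpace ℝ (Fin d)) (t : ℝ) :
    EuclideanSpace ℝ (Fin d) :=
  WithLp.toLp 2 (Function.update (WithLp.ofLp x) k t)

lemma measurable_dropCoord {d : ℕ} (k : Fin d) : Measurable (dropCoord k) := by
  unfold dropCoord
  fun_prop

lemma measurable_setCoord {d : ℕ} (k : Fin d) :
    Measurable fun p : EuclideanSpace ℝ (Fin d) × ℝ => setCoord k p.1 p.2 := by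
  unfold setCoord
  refine (WithLp.measurable_toLp 2 _).comp (measurable_pi_lambda _ fun j => ?_)
  rcases eq_or_ne j k with rfl | hj
  · simpa using measurable_snd
  · simp only [Function.update_of_ne hj]
    fun_prop

/-- The family `κ` is a version of the one-dimensional full conditional distributions of `π`:
if `X ∼ π`, then `κ k x_{-k} = π(· ∣ x_{-k})` is a regular conditional distribution of `X_k`
given `X_{-k} = x_{-k}`. -/
def IsFullConditional {d : ℕ} (π : Measure (EuclideanSpace ℝ (Fin d)))
    (κ : (k : Fin d) → Kernel (EuclideanSpace ℝ {j : Fin d // j ≠ k}) ℝ) : Prop :=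
  ∀ k, HasCondDistrib (fun x : EuclideanSpace ℝ (Fin d) => x k) (dropCoord k) (κ k) π

/-- The conditional distributions are `(M, β)`-TV continuous. -/
def IsTVContinuous {d : ℕ}
    (κ : (k : Fin d) → Kernel (EuclideanSpace ℝ {j : Fin d // j ≠ k}) ℝ) (M β : ℝ) : Prop :=
  ∀ (k : Fin d) (x y : EuclideanSpace ℝ (Fin d)),
    tvDist (κ k (dropCoord k x)) (κ k (dropCoord k y)) ≤
      M * ‖dropCoord k x - dropCoord k y‖ ^ β

/-- The kernel `P_k(x, dy) = π(dy_k ∣ x_{-k}) δ_{x_{-k}}(dy_{-k})`, which resamples the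
coordinate `k` from its conditional distribution and keeps the other coordinates: `P_k(x, ·)` is
the law of `(x_{-k}, Y)` with `Y ∼ π(· ∣ x_{-k})`. -/
noncomputable def coordKernel {d : ℕ} (k : Fin d)
    (κ : Kernel (EuclideanSpace ℝ {j : Fin d // j ≠ k}) ℝ) [IsMarkovKernel κ] :
    Kernel (EuclideanSpace ℝ (Fin d)) (EuclideanSpace ℝ (Fin d)) where
  toFun x := (κ (dropCoord k x)).map (setCoord k x)
  measurable' := by
    refine Measure.measurable_of_measurable_coe _ fun s hs => ?_
    have h : ∀ x, Measurable (setCoord k x) := fun x =>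
      (measurable_setCoord k).comp measurable_prodMk_left
    simp_rw [Measure.map_apply (h _) hs]
    exact Kernel.measurable_kernel_prodMk_left
      (κ := κ.comap (dropCoord k) (measurable_dropCoord k)) (measurable_setCoord k hs)

/-- The random-scan Gibbs kernel `P_RS = (1 / d) ∑_k P_k`. -/
noncomputable def randomScan {d : ℕ}
    (κ : (k : Fin d) → Kernel (EuclideanSpace ℝ {j : Fin d // j ≠ k}) ℝ)
    [∀ k, IsMarkovKernel (κ k)] :
    Kernel (EuclideanSpace ℝ (Fin d)) (EuclideanSpace ℝ (Fin d)) where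
  toFun x := (d : ℝ≥0∞)⁻¹ • ∑ k, coordKernel k (κ k) x
  measurable' := by
    refine Measure.measurable_of_measurable_coe _ fun s hs => ?_
    simp only [Measure.smul_apply, Measure.finsetSum_apply, smul_eq_mul]
    exact (Finset.measurable_sum _ fun k _ =>
      (coordKernel k (κ k)).measurable_coe hs).const_mul _

/-- The `L^q`-Poincaré inequality with constant `C`,
`E[|f - E f|^q] ≤ C⁻¹ E[|∇f|^q]` for locally Lipschitz `f`.
The two explicit conditions on `f` only ask that both sides make sense: that `E f` exists and that
`∇f` exists `π`-almost everywhere. The latter is automatic (Rademacher) if `π` has a density with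
respect to Lebesgue measure. Both sides are allowed to be infinite. -/
def SatisfiesPoincare {d : ℕ} (π : Measure (EuclideanSpace ℝ (Fin d))) (q C : ℝ) : Prop :=
  ∀ f : EuclideanSpace ℝ (Fin d) → ℝ, LocallyLipschitz f → Integrable f π →
    (∀ᵐ x ∂π, DifferentiableAt ℝ f x) →
    ∫⁻ x, ‖f x - ∫ y, f y ∂π‖ₑ ^ q ∂π ≤ ENNReal.ofReal (1 / C) * ∫⁻ x, ‖gradient f x‖ₑ ^ q ∂π

section Chains

variable {X : Type*} [MeasurableSpace X]

/-- The conductance `Φ(P)`: the infimum of `∫_S P(x, Sᶜ) π(dx) / π(S)` over the measurable sets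
`S` with `0 < π(S) ≤ 1/2` (the quotient has no meaning for `π(S) = 0`). -/
noncomputable def conductance (π : Measure X) (P : Kernel X X) : ℝ≥0∞ :=
  ⨅ (S : Set X) (_ : MeasurableSet S) (_ : 0 < π S) (_ : π S ≤ 1 / 2),
    (∫⁻ x in S, P x Sᶜ ∂π) / π S

/-- The spectral gap `λ₂(P)`: the infimum of `⟨f, (I - P) f⟩ / ‖f‖₂²` over the non-zero
`f ∈ L²(π)` with `E f = 0`. -/
noncomputable def spectralGap (π : Measure X) (P : Kernel X X) : EReal :=
  ⨅ (f : X → ℝ) (_ : MemLp f 2 π) (_ : ∫ x, f x ∂π = 0) (_ : ∫ x, f x ^ 2 ∂π ≠ 0),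
    (((∫ x, f x * (f x - ∫ y, f y ∂(P x)) ∂π) / ∫ x, f x ^ 2 ∂π : ℝ) : EReal)

/-- The initial distribution `μ` is an `Ω`-warm start for `π`: `sup_S μ(S) / π(S) ≤ Ω`. -/
def IsWarmStart (μ π : Measure X) (Ω : ℝ) : Prop :=
  ∀ S : Set X, MeasurableSet S → μ S ≤ ENNReal.ofReal Ω * π S

/-- The `ζ`-mixing time `inf {n ≥ 0 : ‖μ Pⁿ - π‖_TV ≤ ζ}` of the chain with kernel `P` and initial
distribution `μ` (it is `∞` if there is no such `n`). -/
noncomputable def mixingTime (μ π : Measure X) (P : Kernel X X) (ζ : ℝ) : ℕ∞ :=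
  ⨅ (n : ℕ) (_ : tvDist (μ.bind ⇑(P ^ n)) π ≤ ζ), (n : ℕ∞)

end Chains

end GibbsSampler

/-! The chain moves well because two copies started close together soon have overlapping laws, while
the Poincaré inequality forbids thin bottlenecks.

Overlap. Run two copies from nearby points, always updating the same coordinate and drawing equal
values whenever possible. While the draws agree, the copies never move apart, so TV continuity
bounds each failure probability by some `e` of order `1 / N`. Once every coordinate has been
refreshed without failure the copies coincide. This is a coupon-collector count: `4 d log d` steps
make a missed coordinate unlikely and keep the expected number of risky updates below a fixed
fraction of `N`. `markovOp_randomScan_pow_sub_le` runs this argument on test functions with values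
in `[0, 1]`, so that no coupling is ever built; `randomScan_pow_overlap` inserts the numbers.

Isoperimetry. Testing the Poincaré inequality on a function that is 0 on `A` and 1 on `B` gives a
lower bound for the mass lying between two separated sets (`SatisfiesPoincare.three_set`). If `S`
had little outflow, most points of `S` would almost surely stay in `S`, and likewise for `Sᶜ`; by
overlap such points of `S` and of `Sᶜ` are far apart, so much mass lies in between, and each point
there carries flow. Hence `conductance_lower_bound`.

Spectral gap and mixing. Cheeger's inequality (`sq_mul_integral_sq_le`) turns conductance into a
gap. Each `P_k` is a conditional expectation, so the random scan and all its powers are symmetric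
and positive semidefinite; a bound on the quadratic form therefore bounds the operator norm on
mean-zero functions, and a warm start transfers the `L²` decay to total variation
(`tvDist_bind_pow_le`). -/

namespace GibbsSampler

/-! ### Kernels acting on bounded measurable functions, where integrability is automatic. -/

section BoundedMeasurable

variable {X Y : Type*} [MeasurableSpace X] [MeasurableSpace Y]

/-- Bounded measurable real functions. -/
structure BddMeasurable (f : X → ℝ) : Prop where
  measurable : Measurable f
  bdd : ∃ B, ∀ x, |f x| ≤ B

namespace BddMeasurable

variable {f g : X → ℝ}

lemma integrable (hf : BddMeasurable f) (μ : Measure X) [IsFiniteMeasure μ] :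
    Integrable f μ := by
  obtain ⟨B, hB⟩ := hf.bdd
  exact Integrable.of_bound hf.measurable.aestronglyMeasurable B
    (Filter.Eventually.of_forall fun x => by simpa using hB x)

lemma const (c : ℝ) : BddMeasurable fun _ : X => c :=
  ⟨measurable_const, |c|, fun _ => le_rfl⟩

lemma add (hf : BddMeasurable f) (hg : BddMeasurable g) : BddMeasurable fun x => f x + g x := by
  obtain ⟨A, hA⟩ := hf.bdd
  obtain ⟨B, hB⟩ := hg.bdd
  exact ⟨hf.measurable.add hg.measurable, A + B,
    fun x => (abs_add_le _ _).trans (add_le_add (hA x) (hB x))⟩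

lemma mul (hf : BddMeasurable f) (hg : BddMeasurable g) : BddMeasurable fun x => f x * g x := by
  obtain ⟨A, hA⟩ := hf.bdd
  obtain ⟨B, hB⟩ := hg.bdd
  refine ⟨hf.measurable.mul hg.measurable, A * B, fun x => ?_⟩
  rw [abs_mul]
  exact mul_le_mul (hA x) (hB x) (abs_nonneg _) ((abs_nonneg _).trans (hA x))

lemma const_mul (hf : BddMeasurable f) (c : ℝ) : BddMeasurable fun x => c * f x :=
  (const c).mul hf

lemma sub (hf : BddMeasurable f) (hg : BddMeasurable g) : BddMeasurable fun x => f x - g x := by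
  simpa [sub_eq_add_neg] using hf.add (hg.const_mul (-1))

lemma comp (hf : BddMeasurable f) {e : Y → X} (he : Measurable e) :
    BddMeasurable fun y => f (e y) := by
  obtain ⟨A, hA⟩ := hf.bdd
  exact ⟨hf.measurable.comp he, A, fun y => hA _⟩

lemma of_mem_Icc (hf : Measurable f) (h0 : ∀ x, 0 ≤ f x) (h1 : ∀ x, f x ≤ 1) :
    BddMeasurable f :=
  ⟨hf, 1, fun x => by rw [abs_of_nonneg (h0 x)]; exact h1 x⟩

end BddMeasurable

/-- The action `f ↦ (x ↦ ∫ f dP(x, ·))` of a kernel on functions. -/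
noncomputable def markovOp (P : Kernel X Y) (f : Y → ℝ) (x : X) : ℝ := ∫ y, f y ∂P x

lemma BddMeasurable.markovOp {f : Y → ℝ} (hf : BddMeasurable f) (P : Kernel X Y)
    [IsMarkovKernel P] : BddMeasurable (markovOp P f) := by
  obtain ⟨B, hB⟩ := hf.bdd
  refine ⟨(hf.measurable.stronglyMeasurable.integral_kernel (κ := P)).measurable, B, fun x => ?_⟩
  have := norm_integral_le_of_norm_le_const (μ := P x) (f := f) (C := B)
    (Filter.Eventually.of_forall fun y => by simpa using hB y)
  simpa [GibbsSampler.markovOp] using this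

lemma markovOp_nonneg (P : Kernel X Y) {f : Y → ℝ} (h0 : ∀ x, 0 ≤ f x) (x : X) :
    0 ≤ markovOp P f x := integral_nonneg h0

lemma markovOp_le_one (P : Kernel X Y) [IsMarkovKernel P] {f : Y → ℝ} (hf : BddMeasurable f)
    (h1 : ∀ x, f x ≤ 1) (x : X) : markovOp P f x ≤ 1 := by
  have := integral_mono (μ := P x) (hf.integrable _) (integrable_const (1 : ℝ)) h1
  simpa [markovOp] using this

lemma markovOp_zero_pow (P : Kernel X X) {f : X → ℝ} (hf : BddMeasurable f) :
    markovOp (P ^ 0) f = f := by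
  funext x
  rw [pow_zero]
  change ∫ y, f y ∂((Kernel.id : Kernel X X) x) = f x
  rw [Kernel.id_apply, integral_dirac' _ _ hf.measurable.stronglyMeasurable]

instance isMarkovKernel_pow (P : Kernel X X) [IsMarkovKernel P] (n : ℕ) :
    IsMarkovKernel (P ^ n) := by
  induction n with
  | zero => rw [pow_zero]; exact inferInstanceAs (IsMarkovKernel (Kernel.id : Kernel X X))
  | succ n ih => rw [pow_succ]; exact inferInstanceAs (IsMarkovKernel ((P ^ n) ∘ₖ P))

lemma markovOp_pow_add (P : Kernel X X) [IsMarkovKernel P] (m n : ℕ) {f : X → ℝ}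
    (hf : BddMeasurable f) : markovOp (P ^ (m + n)) f = markovOp (P ^ m) (markovOp (P ^ n) f) := by
  funext x
  rw [add_comm, pow_add]
  change ∫ y, f y ∂(((P ^ n) ∘ₖ (P ^ m)) x) = _
  rw [Kernel.integral_comp (hf.integrable _)]
  rfl

lemma markovOp_pow_succ (P : Kernel X X) [IsMarkovKernel P] (n : ℕ) {f : X → ℝ}
    (hf : BddMeasurable f) : markovOp (P ^ (n + 1)) f = markovOp P (markovOp (P ^ n) f) := by
  rw [add_comm, markovOp_pow_add P 1 n hf, pow_one]

lemma markovOp_pow_succ' (P : Kernel X X) [IsMarkovKernel P] (n : ℕ) {f : X → ℝ}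
    (hf : BddMeasurable f) : markovOp (P ^ (n + 1)) f = markovOp (P ^ n) (markovOp P f) := by
  rw [markovOp_pow_add P n 1 hf, pow_one]

end BoundedMeasurable

/-! ### Total variation and test functions. -/

section TotalVariation

variable {X : Type*} [MeasurableSpace X]

lemma abs_measureReal_sub_le_tvDist (μ ν : Measure X) [IsProbabilityMeasure μ]
    [IsProbabilityMeasure ν] {S : Set X} (hS : MeasurableSet S) :
    |μ.real S - ν.real S| ≤ tvDist μ ν := by
  refine le_ciSup (f := fun S : {S : Set X // MeasurableSet S} => |μ.real S.1 - ν.real S.1|)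
    ⟨1, ?_⟩ ⟨S, hS⟩
  rintro _ ⟨T, rfl⟩
  have h1 : μ.real T.1 ≤ 1 := measureReal_le_one
  have h2 : ν.real T.1 ≤ 1 := measureReal_le_one
  have h3 : 0 ≤ μ.real T.1 := measureReal_nonneg
  have h4 : 0 ≤ ν.real T.1 := measureReal_nonneg
  exact abs_le.2 ⟨by linarith, by linarith⟩

lemma tvDist_self (μ : Measure X) : tvDist μ μ = 0 := by
  simp [tvDist]

lemma tvDist_le {μ ν : Measure X} {c : ℝ}
    (h : ∀ S, MeasurableSet S → |μ.real S - ν.real S| ≤ c) : tvDist μ ν ≤ c := by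
  have : Nonempty {S : Set X // MeasurableSet S} := ⟨⟨∅, .empty⟩⟩
  exact ciSup_le fun S => h S.1 S.2

/-- Layer cake: both integrals are averages over `t` in `(0, 1]` of the measures of the superlevel
sets `{f ≥ t}`, and each of these differs by at most the total variation distance. -/
lemma integral_sub_integral_le_tvDist (μ ν : Measure X) [IsProbabilityMeasure μ]
    [IsProbabilityMeasure ν] {f : X → ℝ} (hf : Measurable f) (h0 : ∀ x, 0 ≤ f x)
    (h1 : ∀ x, f x ≤ 1) : ∫ x, f x ∂μ - ∫ x, f x ∂ν ≤ tvDist μ ν := by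
  have hb := BddMeasurable.of_mem_Icc hf h0 h1
  have key : ∀ (ρ : Measure X) [IsProbabilityMeasure ρ],
      ∫ x, f x ∂ρ = ∫ t in Set.Ioc 0 (1 : ℝ), ρ.real {a : X | t ≤ f a} := fun ρ _ =>
    (hb.integrable ρ).integral_eq_integral_Ioc_meas_le (Filter.Eventually.of_forall h0)
      (Filter.Eventually.of_forall h1)
  have hint : ∀ (ρ : Measure X) [IsProbabilityMeasure ρ],
      IntegrableOn (fun t => ρ.real {a : X | t ≤ f a}) (Set.Ioc 0 (1 : ℝ)) := fun ρ _ => by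
    refine Integrable.of_bound (C := 1) (Antitone.measurable fun s t hst => ?_).aestronglyMeasurable
      (Filter.Eventually.of_forall fun t => ?_)
    · exact measureReal_mono fun a (ha : t ≤ f a) => hst.trans ha
    · rw [Real.norm_of_nonneg measureReal_nonneg]; exact measureReal_le_one
  rw [key μ, key ν, ← integral_sub (hint μ) (hint ν)]
  have := setIntegral_mono_on (μ := volume) (s := Set.Ioc 0 (1 : ℝ)) ((hint μ).sub (hint ν))
    (integrableOn_const (by simp) : IntegrableOn (fun _ => tvDist μ ν) (Set.Ioc 0 (1 : ℝ)))
    measurableSet_Ioc (fun t _ => (le_abs_self _).trans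
      (abs_measureReal_sub_le_tvDist μ ν (measurableSet_le measurable_const hf)))
  simpa using this

end TotalVariation

/-! ### Overlap of the laws of nearby chains. -/

section Gibbs

variable {d : ℕ}

lemma measurable_setCoord_right (k : Fin d) (x : EuclideanSpace ℝ (Fin d)) :
    Measurable (setCoord k x) := (measurable_setCoord k).comp measurable_prodMk_left

instance isMarkovKernel_coordKernel (k : Fin d)
    (κ : Kernel (EuclideanSpace ℝ {j : Fin d // j ≠ k}) ℝ) [IsMarkovKernel κ] :
    IsMarkovKernel (coordKernel k κ) :=
  ⟨fun x => Measure.isProbabilityMeasure_map (measurable_setCoord_right k x).aemeasurable⟩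

instance isMarkovKernel_randomScan [NeZero d]
    (κ : (k : Fin d) → Kernel (EuclideanSpace ℝ {j : Fin d // j ≠ k}) ℝ)
    [∀ k, IsMarkovKernel (κ k)] : IsMarkovKernel (randomScan κ) := by
  refine ⟨fun x => ⟨?_⟩⟩
  change ((d : ℝ≥0∞)⁻¹ • ∑ k, coordKernel k (κ k) x) Set.univ = 1
  simp only [Measure.smul_apply, Measure.finsetSum_apply, measure_univ, smul_eq_mul]
  simp only [Finset.sum_const, Finset.card_univ, Fintype.card_fin, nsmul_eq_mul, mul_one]
  exact ENNReal.inv_mul_cancel (by exact_mod_cast NeZero.ne d) (by simp)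

lemma markovOp_coordKernel (k : Fin d)
    (κ : Kernel (EuclideanSpace ℝ {j : Fin d // j ≠ k}) ℝ) [IsMarkovKernel κ]
    {f : EuclideanSpace ℝ (Fin d) → ℝ} (hf : BddMeasurable f) (x : EuclideanSpace ℝ (Fin d)) :
    markovOp (coordKernel k κ) f x = ∫ t, f (setCoord k x t) ∂κ (dropCoord k x) :=
  integral_map (measurable_setCoord_right k x).aemeasurable hf.measurable.aestronglyMeasurable

lemma markovOp_randomScan (κ : (k : Fin d) → Kernel (EuclideanSpace ℝ {j : Fin d // j ≠ k}) ℝ)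
    [∀ k, IsMarkovKernel (κ k)] {f : EuclideanSpace ℝ (Fin d) → ℝ} (hf : BddMeasurable f)
    (x : EuclideanSpace ℝ (Fin d)) :
    markovOp (randomScan κ) f x = (d : ℝ)⁻¹ * ∑ k, markovOp (coordKernel k (κ k)) f x := by
  change ∫ y, f y ∂((d : ℝ≥0∞)⁻¹ • ∑ k, coordKernel k (κ k) x) = _
  rw [integral_smul_measure, integral_finsetSum_measure fun k _ => hf.integrable _]
  simp [markovOp]

lemma dropCoord_eq_of_eqOn {k : Fin d} {x y : EuclideanSpace ℝ (Fin d)}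
    (h : ∀ j, j ≠ k → x j = y j) : dropCoord k x = dropCoord k y := by
  ext j
  exact h j.1 j.2

lemma norm_dropCoord_sub_le (k : Fin d) (x y : EuclideanSpace ℝ (Fin d)) :
    ‖dropCoord k x - dropCoord k y‖ ≤ ‖x - y‖ := by
  rw [EuclideanSpace.norm_eq, EuclideanSpace.norm_eq]
  refine Real.sqrt_le_sqrt ?_
  calc ∑ i, ‖(dropCoord k x - dropCoord k y) i‖ ^ 2
      = ∑ i : {j : Fin d // j ≠ k}, ‖(x - y) i.1‖ ^ 2 := rfl
    _ = ∑ i ∈ Finset.univ.filter fun j : Fin d => j ≠ k, ‖(x - y) i‖ ^ 2 :=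
        (Finset.sum_subtype (p := fun j => j ≠ k) _ (fun j => by simp) fun i => ‖(x - y) i‖ ^ 2).symm
    _ ≤ ∑ i, ‖(x - y) i‖ ^ 2 :=
        Finset.sum_le_univ_sum_of_nonneg fun i => by positivity

lemma setCoord_apply (k j : Fin d) (x : EuclideanSpace ℝ (Fin d)) (t : ℝ) :
    setCoord k x t j = if j = k then t else x j := by
  simp [setCoord, Function.update_apply]

lemma norm_setCoord_sub_le (k : Fin d) (x y : EuclideanSpace ℝ (Fin d)) (t : ℝ) :
    ‖setCoord k x t - setCoord k y t‖ ≤ ‖x - y‖ := by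
  rw [EuclideanSpace.norm_eq, EuclideanSpace.norm_eq]
  refine Real.sqrt_le_sqrt (Finset.sum_le_sum fun i _ => ?_)
  simp only [PiLp.sub_apply, setCoord_apply]
  split_ifs
  · simp
    positivity
  · exact le_rfl

/-- Expected number of updates, before all of the `u` outstanding coordinates out of `d` have been
resampled, at which the conditional distributions of the two copies may differ. -/
noncomputable def couponWeight (d u : ℕ) : ℝ := if u = 0 then 0 else d * (harmonic u : ℝ) - 1

/-- First-step analysis with `u + 1` outstanding coordinates: every update costs one unit except the
one that resamples the last of them, where the other coordinates already agree. That free update is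
the `- 1` in `couponWeight`. -/
lemma couponWeight_step {d u : ℕ} :
    (u + 1 : ℝ) * (couponWeight d u + if u = 0 then 0 else 1) +
      (d - (u + 1)) * (couponWeight d (u + 1) + 1) = d * couponWeight d (u + 1) := by
  rcases Nat.eq_zero_or_pos u with rfl | hu
  · simp [couponWeight]
    ring
  · have : (u : ℝ) + 1 ≠ 0 := by positivity
    simp only [couponWeight, hu.ne', if_false, Nat.succ_ne_zero, harmonic_succ]
    push_cast
    field_simp
    ring

/-- One coordinate update started from two points contracts test functions up to the total
variation distance of the two conditional distributions. -/
lemma markovOp_coordKernel_sub_le (k : Fin d)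
    (κ : Kernel (EuclideanSpace ℝ {j : Fin d // j ≠ k}) ℝ) [IsMarkovKernel κ]
    {f : EuclideanSpace ℝ (Fin d) → ℝ} (hf : Measurable f) (h0 : ∀ x, 0 ≤ f x)
    (h1 : ∀ x, f x ≤ 1) {x y : EuclideanSpace ℝ (Fin d)} {b : ℝ}
    (hb : ∀ t, f (setCoord k x t) - f (setCoord k y t) ≤ b) :
    markovOp (coordKernel k κ) f x - markovOp (coordKernel k κ) f y ≤
      b + tvDist (κ (dropCoord k x)) (κ (dropCoord k y)) := by
  have hB := BddMeasurable.of_mem_Icc hf h0 h1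
  rw [markovOp_coordKernel k κ hB, markovOp_coordKernel k κ hB]
  have hx := (hB.comp (measurable_setCoord_right k x)).integrable (κ (dropCoord k x))
  -- The intermediate term integrates the section through `y` against the conditional law at `x`:
  -- first the section changes under a common law, then the law.
  have hy := (hB.comp (measurable_setCoord_right k y)).integrable (κ (dropCoord k x))
  have h2 := integral_mono (μ := κ (dropCoord k x)) (hx.sub hy) (integrable_const b) hb
  have h3 := integral_sub_integral_le_tvDist (κ (dropCoord k x)) (κ (dropCoord k y))
    (hf.comp (measurable_setCoord_right k y)) (fun _ => h0 _) (fun _ => h1 _)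
  simp only [Pi.sub_apply] at h2
  rw [integral_sub hx hy] at h2
  simp only [integral_const, probReal_univ, one_smul] at h2
  simp only [Function.comp_apply] at h3
  linarith

/-- Dual form of the coupling, with `U` containing all coordinates where the two points may differ.
The first term is a union bound for some coordinate of `U` not being drawn in `n` steps; the second
charges `e` for each risky update. Induction is on `n`: an update in `U` removes that coordinate, an
update outside leaves `U` unchanged, and neither increases the distance. -/
lemma markovOp_randomScan_pow_sub_le [NeZero d]
    (κ : (k : Fin d) → Kernel (EuclideanSpace ℝ {j : Fin d // j ≠ k}) ℝ)
    [∀ k, IsMarkovKernel (κ k)] {e δ : ℝ} (he : 0 ≤ e)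
    (hκ : ∀ k x y, ‖x - y‖ ≤ δ → tvDist (κ k (dropCoord k x)) (κ k (dropCoord k y)) ≤ e)
    {f : EuclideanSpace ℝ (Fin d) → ℝ} (hf : Measurable f) (h0 : ∀ x, 0 ≤ f x)
    (h1 : ∀ x, f x ≤ 1) (n : ℕ) : ∀ (U : Finset (Fin d)) (x y : EuclideanSpace ℝ (Fin d)),
      (∀ j, j ∉ U → x j = y j) → ‖x - y‖ ≤ δ →
      markovOp (randomScan κ ^ n) f x - markovOp (randomScan κ ^ n) f y ≤
        U.card * (1 - (d : ℝ)⁻¹) ^ n + e * couponWeight d U.card := by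
  have hB := BddMeasurable.of_mem_Icc hf h0 h1
  have hd : (0 : ℝ) < d := by exact_mod_cast NeZero.pos d
  have hd1 : 1 ≤ d := NeZero.pos d
  have hzero : ∀ (n : ℕ) (x y : EuclideanSpace ℝ (Fin d)), (∀ j, x j = y j) →
      markovOp (randomScan κ ^ n) f x - markovOp (randomScan κ ^ n) f y ≤ 0 := by
    intro n x y h
    have : x = y := by ext j; exact h j
    simp [this]
  have hw : ∀ u, 0 ≤ couponWeight d u := by
    intro u
    rcases Nat.eq_zero_or_pos u with rfl | hu
    · simp [couponWeight]
    · have h2 : (1 : ℝ) ≤ (harmonic u : ℝ) := by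
        have : (1 : ℚ) ≤ harmonic u := by
          rw [harmonic_eq_sum_Icc]
          exact (by simp : (1 : ℚ) ≤ ((1 : ℕ) : ℚ)⁻¹).trans
            (Finset.single_le_sum (f := fun i : ℕ => ((i : ℚ))⁻¹) (fun i _ => by positivity)
              (Finset.mem_Icc.2 ⟨le_rfl, hu⟩))
        exact_mod_cast this
      have h3 : (1 : ℝ) ≤ d := by exact_mod_cast hd1
      simp only [couponWeight, hu.ne', if_false]
      nlinarith
  induction n with
  | zero =>
    intro U x y hU hxy
    rcases U.eq_empty_or_nonempty with rfl | hne
    · simpa [couponWeight] using hzero 0 x y (by simpa using hU)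
    · rw [markovOp_zero_pow _ hB]
      have h2 : (1 : ℝ) ≤ U.card := by exact_mod_cast hne.card_pos
      have := mul_nonneg he (hw U.card)
      simp only [pow_zero, mul_one]
      linarith [h1 x, h0 y]
  | succ n ih =>
    intro U x y hU hxy
    rcases U.eq_empty_or_nonempty with rfl | hne
    · simpa [couponWeight] using hzero (n + 1) x y (by simpa using hU)
    obtain ⟨u, hu⟩ : ∃ u, U.card = u + 1 := ⟨U.card - 1, by have := hne.card_pos; omega⟩
    set ρ : ℝ := 1 - (d : ℝ)⁻¹ with hρ
    set g := markovOp (randomScan κ ^ n) f with hg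
    have hgB : BddMeasurable g := hB.markovOp _
    have hg0 : ∀ x, 0 ≤ g x := markovOp_nonneg _ h0
    have hg1 : ∀ x, g x ≤ 1 := markovOp_le_one _ hB h1
    rw [markovOp_pow_succ _ _ hB, markovOp_randomScan κ hgB, markovOp_randomScan κ hgB,
      ← mul_sub, ← Finset.sum_sub_distrib]
    have hin : ∀ k ∈ U, markovOp (coordKernel k (κ k)) g x - markovOp (coordKernel k (κ k)) g y ≤
        (u * ρ ^ n + e * couponWeight d u) + e * (if u = 0 then 0 else 1) := by
      intro k hk
      have hcard : (U.erase k).card = u := by rw [Finset.card_erase_of_mem hk, hu]; rfl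
      refine (markovOp_coordKernel_sub_le k (κ k) hgB.measurable hg0 hg1
        (b := u * ρ ^ n + e * couponWeight d u) fun t => ?_).trans (add_le_add le_rfl ?_)
      · rw [← hcard]
        refine ih (U.erase k) _ _ (fun j hj => ?_) ((norm_setCoord_sub_le k x y t).trans hxy)
        rw [setCoord_apply, setCoord_apply]
        split_ifs with hjk
        · rfl
        · exact hU j fun h => hj (Finset.mem_erase.2 ⟨hjk, h⟩)
      -- If `k` is the only element of `U`, the two conditional laws are equal and the update is
      -- free.
      · split_ifs with h
        · have : dropCoord k x = dropCoord k y := by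
            refine dropCoord_eq_of_eqOn fun j hj => hU j fun hjU => ?_
            have h3 : j ∈ U.erase k := Finset.mem_erase.2 ⟨hj, hjU⟩
            rw [Finset.card_eq_zero.1 (hcard.trans h)] at h3
            simp at h3
          simp [this, tvDist_self]
        · simpa using hκ k x y hxy
    have hout : ∀ k ∈ Uᶜ, markovOp (coordKernel k (κ k)) g x -
        markovOp (coordKernel k (κ k)) g y ≤
        ((u + 1) * ρ ^ n + e * couponWeight d (u + 1)) + e := by
      intro k hk
      refine (markovOp_coordKernel_sub_le k (κ k) hgB.measurable hg0 hg1
        (b := (u + 1) * ρ ^ n + e * couponWeight d (u + 1)) fun t => ?_).trans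
          (add_le_add le_rfl (hκ k x y hxy))
      have := ih U (setCoord k x t) (setCoord k y t) (fun j hj => by
        rw [setCoord_apply, setCoord_apply, hU j hj]) ((norm_setCoord_sub_le k x y t).trans hxy)
      rw [hu] at this
      exact_mod_cast this
    rw [← Finset.sum_add_sum_compl U]
    have s1 := Finset.sum_le_card_nsmul U _ _ hin
    have s2 := Finset.sum_le_card_nsmul Uᶜ _ _ hout
    rw [nsmul_eq_mul] at s1 s2
    have hle : u + 1 ≤ d := by
      rw [← hu]; simpa using Finset.card_le_univ U
    rw [Finset.card_compl, Fintype.card_fin, hu, Nat.cast_sub hle] at s2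
    rw [hu] at s1 ⊢
    push_cast at s1 s2 ⊢
    have hstep := couponWeight_step (d := d) (u := u)
    refine (mul_le_mul_of_nonneg_left (add_le_add s1 s2) (by positivity)).trans (le_of_eq ?_)
    rw [inv_mul_eq_iff_eq_mul₀ hd.ne']
    have hρd : (d : ℝ) * ρ = d - 1 := by rw [hρ]; field_simp
    have : (d : ℝ) * ((u + 1) * ρ ^ (n + 1)) = (u + 1) * ((d - 1) * ρ ^ n) := by
      rw [← hρd]; ring
    linear_combination e * hstep - this

/-- The left side is the harmonic number of `d - 1`. The factor `3 / 2` already suffices at `d = 2`,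
and the increment needs `1 / n ≤ 3 / (2 (n + 1))`, that is, `n ≥ 2`. -/
lemma harmonic_sub_inv_le_log {d : ℕ} (hd : 2 ≤ d) :
    (harmonic d : ℝ) - (d : ℝ)⁻¹ ≤ 3 / 2 * Real.log d := by
  induction d, hd using Nat.le_induction with
  | base =>
    have := Real.log_two_gt_d9
    norm_num [harmonic]
    norm_num at this
    linarith
  | succ n hn ih =>
    have hn' : (2 : ℝ) ≤ n := by exact_mod_cast hn
    have h0 : (0 : ℝ) < n := by linarith
    have h1 := Real.one_sub_inv_le_log_of_pos (x := ((n : ℝ) + 1) / n) (by positivity)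
    rw [Real.log_div (by positivity) (by positivity)] at h1
    have h2 : (n : ℝ)⁻¹ ≤ 3 / 2 * (1 - (((n : ℝ) + 1) / n)⁻¹) := by
      rw [inv_div, inv_le_iff_one_le_mul₀ h0]
      have h3 : (1 : ℝ) - n / (n + 1) = 1 / (n + 1) := by field_simp; ring
      rw [h3]
      have : 3 / 2 * (1 / ((n : ℝ) + 1)) * n = 3 * n / (2 * (n + 1)) := by field_simp
      rw [this, le_div_iff₀ (by positivity)]
      linarith
    rw [harmonic_succ]
    push_cast at ih ⊢
    linarith

/-- After `⌈4 d log d⌉` steps two random-scan Gibbs chains started close to each other have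
overlapping laws. -/
lemma randomScan_pow_overlap (hd : 2 ≤ d)
    (κ : (k : Fin d) → Kernel (EuclideanSpace ℝ {j : Fin d // j ≠ k}) ℝ)
    [∀ k, IsMarkovKernel (κ k)] {N : ℕ} (hN : N = ⌈4 * (d : ℝ) * Real.log d⌉₊) {δ : ℝ}
    (hκ : ∀ k x y, ‖x - y‖ ≤ δ →
      tvDist (κ k (dropCoord k x)) (κ k (dropCoord k y)) ≤ 17 / 8 / N)
    {f : EuclideanSpace ℝ (Fin d) → ℝ} (hf : Measurable f) (h0 : ∀ x, 0 ≤ f x)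
    (h1 : ∀ x, f x ≤ 1) {x y : EuclideanSpace ℝ (Fin d)} (hxy : ‖x - y‖ ≤ δ) :
    markovOp (randomScan κ ^ N) f x - markovOp (randomScan κ ^ N) f y ≤ 15 / 16 := by
  have : NeZero d := ⟨by omega⟩
  have hd' : (2 : ℝ) ≤ d := by exact_mod_cast hd
  have hd0 : (0 : ℝ) < d := by linarith
  have hlog : 0 < Real.log d := Real.log_pos (by linarith)
  have hNle : 4 * (d : ℝ) * Real.log d ≤ N := by rw [hN]; exact Nat.le_ceil _
  have hN0 : (0 : ℝ) < N := lt_of_lt_of_le (by positivity) hNle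
  have h := markovOp_randomScan_pow_sub_le κ (e := 17 / 8 / N) (by positivity) hκ hf h0 h1 N
    Finset.univ x y (by simp) hxy
  rw [Finset.card_univ, Fintype.card_fin] at h
  refine h.trans ?_
  -- The 4 in `N` makes the chance of missing a given coordinate at most `d⁻⁴`, so the union bound
  -- is `d⁻³ ≤ 1 / 8`.
  have hA : (d : ℝ) * (1 - (d : ℝ)⁻¹) ^ N ≤ 1 / 8 := by
    have hr0 : 0 ≤ 1 - (d : ℝ)⁻¹ := by
      have : (d : ℝ)⁻¹ ≤ 1 := inv_le_one_of_one_le₀ (by linarith)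
      linarith
    have e1 : (1 - (d : ℝ)⁻¹) ^ N ≤ Real.exp (-(4 * Real.log d)) := by
      calc (1 - (d : ℝ)⁻¹) ^ N ≤ Real.exp (-(d : ℝ)⁻¹) ^ N := by
            refine pow_le_pow_left₀ hr0 ?_ _
            have := Real.add_one_le_exp (-(d : ℝ)⁻¹)
            linarith
        _ = Real.exp (-(N * (d : ℝ)⁻¹)) := by rw [← Real.exp_nat_mul]; ring_nf
        _ ≤ _ := by
            refine Real.exp_le_exp.2 (neg_le_neg ?_)
            rw [← div_eq_mul_inv, le_div_iff₀ hd0]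
            linarith
    have e2 : Real.exp (-(4 * Real.log d)) = ((d : ℝ) ^ 4)⁻¹ := by
      rw [Real.exp_neg, show (4 : ℝ) * Real.log d = (4 : ℕ) * Real.log d by norm_num,
        Real.exp_nat_mul, Real.exp_log hd0]
    rw [e2] at e1
    calc (d : ℝ) * (1 - (d : ℝ)⁻¹) ^ N ≤ d * ((d : ℝ) ^ 4)⁻¹ :=
          mul_le_mul_of_nonneg_left e1 hd0.le
      _ = ((d : ℝ) ^ 3)⁻¹ := by field_simp
      _ ≤ ((2 : ℝ) ^ 3)⁻¹ := by gcongr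
      _ = 1 / 8 := by norm_num
  have hW : couponWeight d d ≤ 3 / 8 * N := by
    have h3 := harmonic_sub_inv_le_log hd
    have : couponWeight d d = d * ((harmonic d : ℝ) - (d : ℝ)⁻¹) := by
      rw [couponWeight, if_neg (by omega), mul_sub, mul_inv_cancel₀ hd0.ne']
    rw [this]
    nlinarith
  -- In total `1 / 8 + 51 / 64 = 59 / 64`, just below `15 / 16`; this leaves room for 17/8 in place
  -- of 2.
  have hB : 17 / 8 / (N : ℝ) * couponWeight d d ≤ 51 / 64 := by
    calc 17 / 8 / (N : ℝ) * couponWeight d d ≤ 17 / 8 / (N : ℝ) * (3 / 8 * N) :=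
          mul_le_mul_of_nonneg_left hW (by positivity)
      _ = 51 / 64 := by field_simp; norm_num
  linarith

end Gibbs

/-- The infimum of the points where the distribution function reaches `1 / 2` works; both open
half-lines are exhausted by monotone unions. In Cheeger's argument it splits a function into two
parts, each vanishing on at least half the space. -/
lemma exists_median (ν : Measure ℝ) [IsProbabilityMeasure ν] :
    ∃ m, ν (Set.Ioi m) ≤ 1 / 2 ∧ ν (Set.Iio m) ≤ 1 / 2 := by
  have hcdf : ∀ t, ν.real (Set.Ioi t) = 1 - cdf ν t := fun t => by
    rw [cdf_eq_real, ← Set.compl_Iic, measureReal_compl measurableSet_Iic, probReal_univ]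
  set S : Set ℝ := {t | 1 / 2 ≤ cdf ν t} with hS
  have hne : S.Nonempty := by
    obtain ⟨t, ht⟩ := ((tendsto_cdf_atTop ν).eventually
      (lt_mem_nhds (show (1 / 2 : ℝ) < 1 by norm_num))).exists
    exact ⟨t, ht.le⟩
  have hbdd : BddBelow S := by
    obtain ⟨t, ht⟩ := ((tendsto_cdf_atBot ν).eventually
      (gt_mem_nhds (show (0 : ℝ) < 1 / 2 by norm_num))).exists
    refine ⟨t, fun s hs => ?_⟩
    by_contra hst
    exact absurd (hs.trans (monotone_cdf ν (not_le.1 hst).le)) (not_le.2 ht)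
  have hhalf : ∀ {A : Set ℝ}, ν.real A ≤ 1 / 2 → ν A ≤ 1 / 2 := fun {A} h => by
    rw [← ofReal_measureReal (μ := ν) (s := A)]
    refine (ENNReal.ofReal_le_ofReal h).trans (le_of_eq ?_)
    rw [ENNReal.ofReal_div_of_pos (by norm_num)]
    simp
  refine ⟨sInf S, ?_, ?_⟩
  · obtain ⟨u, huA, hu, hlim⟩ := exists_seq_strictAnti_tendsto (sInf S)
    rw [← iUnion_Ici_eq_Ioi_of_lt_of_tendsto hu hlim,
      Monotone.measure_iUnion fun i j hij => Set.Ici_subset_Ici.2 (huA.antitone hij)]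
    refine iSup_le fun n => ?_
    obtain ⟨s, hs, hsu⟩ := (csInf_lt_iff hbdd hne).1 (hu n)
    refine (measure_mono (Set.Ici_subset_Ioi.2 hsu)).trans (hhalf ?_)
    rw [hcdf]
    have : 1 / 2 ≤ cdf ν s := hs
    linarith
  · obtain ⟨u, huM, hu, hlim⟩ := exists_seq_strictMono_tendsto (sInf S)
    rw [← iUnion_Iic_eq_Iio_of_lt_of_tendsto hu hlim,
      Monotone.measure_iUnion fun i j hij => Set.Iic_subset_Iic.2 (huM.monotone hij)]
    refine iSup_le fun n => hhalf ?_
    rw [← cdf_eq_real]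
    by_contra hcon
    exact absurd (csInf_le hbdd (show u n ∈ S from (not_le.1 hcon).le)) (not_le.2 (hu n))

/-! ### Cheeger's inequality for reversible kernels. -/

section Cheeger

variable {X : Type*} [MeasurableSpace X] {π : Measure X} [IsProbabilityMeasure π]
  {P : Kernel X X} [IsMarkovKernel P]

lemma measurePreserving_swap_compProd (hrev : P.IsReversible π) :
    MeasurePreserving Prod.swap (π ⊗ₘ P) (π ⊗ₘ P) := by
  refine ⟨measurable_swap, ?_⟩
  have : IsFiniteMeasure ((π ⊗ₘ P).map Prod.swap) := by infer_instance
  refine Measure.ext_prod fun {s t} hs ht => ?_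
  rw [Measure.map_apply measurable_swap (hs.prod ht), Set.preimage_swap_prod,
    Measure.compProd_apply_prod ht hs, Measure.compProd_apply_prod hs ht]
  exact hrev ht hs

lemma measurePreserving_fst_compProd : MeasurePreserving Prod.fst (π ⊗ₘ P) π :=
  ⟨measurable_fst, Measure.fst_compProd π P⟩

lemma measurePreserving_snd_compProd (hrev : P.IsReversible π) :
    MeasurePreserving Prod.snd (π ⊗ₘ P) π := by
  have := (measurePreserving_fst_compProd (π := π) (P := P)).comp
    (measurePreserving_swap_compProd hrev)
  exact this

/-- A lower bound on the conductance controls the variation of functions that vanish on at least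
half of the space (coarea formula). -/
lemma coarea_le_lintegral {φ : ℝ≥0∞}
    (hφ : ∀ S, MeasurableSet S → π S ≤ 1 / 2 → φ * π S ≤ ∫⁻ x in S, P x Sᶜ ∂π)
    {a : X → ℝ} (ha : Measurable a) (h0 : ∀ x, 0 ≤ a x) (hhalf : π {x | 0 < a x} ≤ 1 / 2) :
    φ * ∫⁻ x, ENNReal.ofReal (a x) ∂π ≤
      ∫⁻ p, ENNReal.ofReal (a p.1 - a p.2) ∂(π ⊗ₘ P) := by
  set ℓ : Measure ℝ := volume.restrict (Set.Ioi 0)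
  -- The region of (jump, level) pairs where the jump goes down across the level. Its slice at a
  -- jump has length `(a x - a y)⁺`; its slice at a level is the flow out of a superlevel set.
  set T : Set ((X × X) × ℝ) := {z | a z.1.2 ≤ z.2 ∧ z.2 < a z.1.1} with hT
  have hTm : MeasurableSet T :=
    (measurableSet_le (ha.comp (measurable_snd.comp measurable_fst)) measurable_snd).inter
      (measurableSet_lt measurable_snd (ha.comp (measurable_fst.comp measurable_fst)))
  have e1 : ((π ⊗ₘ P).prod ℓ) T ≤ ∫⁻ p, ENNReal.ofReal (a p.1 - a p.2) ∂(π ⊗ₘ P) := by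
    rw [Measure.prod_apply hTm]
    refine lintegral_mono fun p => ?_
    refine (Measure.restrict_apply_le _ _).trans (le_of_eq ?_)
    rw [← Real.volume_Ico]
    rfl
  refine le_trans ?_ e1
  have hdist : Measurable fun t => π {x | t < a x} :=
    Antitone.measurable fun s t hst => measure_mono fun x (hx : t < a x) => lt_of_le_of_lt hst hx
  rw [Measure.prod_apply_symm hTm,
    lintegral_eq_lintegral_meas_lt π (Filter.Eventually.of_forall h0) ha.aemeasurable,
    ← lintegral_const_mul _ hdist]
  refine setLIntegral_mono' measurableSet_Ioi fun t ht => ?_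
  have hSm : MeasurableSet {x | t < a x} := measurableSet_lt measurable_const ha
  refine (hφ _ hSm ((measure_mono fun x (hx : t < a x) => lt_trans ht hx).trans hhalf)).trans
    (le_of_eq ?_)
  rw [← Measure.compProd_apply_prod hSm hSm.compl]
  congr 1
  ext p
  simp [T, and_comm]

lemma memLp_comp_sub {f : X → ℝ} (hf : MemLp f 2 π) (hrev : P.IsReversible π) :
    MemLp (fun p : X × X => f p.1 - f p.2) 2 (π ⊗ₘ P) :=
  (hf.comp_measurePreserving measurePreserving_fst_compProd).sub
    (hf.comp_measurePreserving (measurePreserving_snd_compProd hrev))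

/-- Apply the coarea bound to `h²`, and then estimate `|h(x)² - h(y)²| = |h(x) - h(y)| (h(x) +
h(y))` by a weighted AM-GM inequality instead of Cauchy–Schwarz. -/
lemma sq_mul_integral_sq_le_of_half {φ : ℝ} (hφ0 : 0 < φ) (hrev : P.IsReversible π)
    (hφ : ∀ S, MeasurableSet S → π S ≤ 1 / 2 → ENNReal.ofReal φ * π S ≤ ∫⁻ x in S, P x Sᶜ ∂π)
    {h : X → ℝ} (hm : Measurable h) (hL : MemLp h 2 π) (h0 : ∀ x, 0 ≤ h x)
    (hhalf : π {x | 0 < h x} ≤ 1 / 2) :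
    φ ^ 2 * ∫ x, h x ^ 2 ∂π ≤ ∫ p, (h p.1 - h p.2) ^ 2 ∂(π ⊗ₘ P) := by
  have hfst := measurePreserving_fst_compProd (π := π) (P := P)
  have hsnd := measurePreserving_snd_compProd (π := π) (P := P) hrev
  have hswap := measurePreserving_swap_compProd (π := π) (P := P) hrev
  have hi : Integrable (fun x => h x ^ 2) π := hL.integrable_sq
  have hi1 : Integrable (fun p : X × X => h p.1 ^ 2) (π ⊗ₘ P) := hfst.integrable_comp_of_integrable hi
  have hi2 : Integrable (fun p : X × X => h p.2 ^ 2) (π ⊗ₘ P) := hsnd.integrable_comp_of_integrable hi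
  have hiD : Integrable (fun p : X × X => (h p.1 - h p.2) ^ 2) (π ⊗ₘ P) :=
    (memLp_comp_sub hL hrev).integrable_sq
  have hE1 : ∫ p, h p.1 ^ 2 ∂(π ⊗ₘ P) = ∫ x, h x ^ 2 ∂π := by
    rw [← hfst.map_eq, integral_map measurable_fst.aemeasurable]
    · rw [hfst.map_eq]
    · exact (hm.pow_const 2).aestronglyMeasurable
  have hE2 : ∫ p, h p.2 ^ 2 ∂(π ⊗ₘ P) = ∫ x, h x ^ 2 ∂π := by
    conv_rhs => rw [← hsnd.map_eq]
    rw [integral_map measurable_snd.aemeasurable]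
    exact (hm.pow_const 2).aestronglyMeasurable
  have hpos : Integrable (fun p : X × X => max (h p.1 ^ 2 - h p.2 ^ 2) 0) (π ⊗ₘ P) :=
    (hi1.sub hi2).pos_part
  have hco : φ * ∫ x, h x ^ 2 ∂π ≤ ∫ p, max (h p.1 ^ 2 - h p.2 ^ 2) 0 ∂(π ⊗ₘ P) := by
    have := coarea_le_lintegral hφ (a := fun x => h x ^ 2) (hm.pow_const 2)
      (fun x => sq_nonneg _) (by
        refine (measure_mono fun x (hx : 0 < h x ^ 2) => ?_).trans hhalf
        exact lt_of_le_of_ne (h0 x) fun hx0 => by simp [← hx0] at hx)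
    rw [← ofReal_integral_eq_lintegral_ofReal hi (Filter.Eventually.of_forall fun x => sq_nonneg _),
      ← ENNReal.ofReal_mul hφ0.le] at this
    have h3 : ∫⁻ p, ENNReal.ofReal (h p.1 ^ 2 - h p.2 ^ 2) ∂(π ⊗ₘ P) =
        ENNReal.ofReal (∫ p, max (h p.1 ^ 2 - h p.2 ^ 2) 0 ∂(π ⊗ₘ P)) := by
      rw [ofReal_integral_eq_lintegral_ofReal hpos
        (Filter.Eventually.of_forall fun p => le_max_right _ _)]
      refine lintegral_congr fun p => ?_
      rcases le_total 0 (h p.1 ^ 2 - h p.2 ^ 2) with h4 | h4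
      · rw [max_eq_left h4]
      · rw [max_eq_right h4, ENNReal.ofReal_of_nonpos h4, ENNReal.ofReal_zero]
    rw [h3] at this
    exact (ENNReal.ofReal_le_ofReal_iff (integral_nonneg fun p => le_max_right _ _)).1 this
  -- Reversibility gives the same bound for upward jumps; adding the two produces the absolute
  -- difference and doubles the left side.
  have hco' : φ * ∫ x, h x ^ 2 ∂π ≤ ∫ p, max (h p.2 ^ 2 - h p.1 ^ 2) 0 ∂(π ⊗ₘ P) := by
    refine hco.trans (le_of_eq ?_)
    conv_lhs => rw [← hswap.map_eq]
    rw [integral_map measurable_swap.aemeasurable]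
    · rfl
    · exact (((hm.comp measurable_fst).pow_const 2).sub
        ((hm.comp measurable_snd).pow_const 2)).max measurable_const |>.aestronglyMeasurable
  have hpos' : Integrable (fun p : X × X => max (h p.2 ^ 2 - h p.1 ^ 2) 0) (π ⊗ₘ P) :=
    (hi2.sub hi1).pos_part
  have hi12 : Integrable (fun p : X × X => h p.1 ^ 2 + h p.2 ^ 2) (π ⊗ₘ P) := hi1.add hi2
  have hmain : ∫ p, (max (h p.1 ^ 2 - h p.2 ^ 2) 0 + max (h p.2 ^ 2 - h p.1 ^ 2) 0) ∂(π ⊗ₘ P) ≤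
      ∫ p, (φ⁻¹ * (h p.1 - h p.2) ^ 2 + φ / 2 * (h p.1 ^ 2 + h p.2 ^ 2)) ∂(π ⊗ₘ P) := by
    refine integral_mono (hpos.add hpos') ((hiD.const_mul _).add (hi12.const_mul _))
      fun p => ?_
    -- The weight `φ` is chosen so that, after integration, the second term is `φ ∫ h²`, half of the
    -- left side, and can be absorbed.
    have key : ∀ u v : ℝ, u ^ 2 - v ^ 2 ≤ φ⁻¹ * (u - v) ^ 2 + φ / 2 * (u ^ 2 + v ^ 2) := by
      intro u v
      have h1 : 0 ≤ φ⁻¹ * ((u - v) - φ / 2 * (u + v)) ^ 2 := by positivity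
      have h2 : φ⁻¹ * ((u - v) - φ / 2 * (u + v)) ^ 2 =
          φ⁻¹ * (u - v) ^ 2 - (u ^ 2 - v ^ 2) + φ / 4 * (u + v) ^ 2 := by
        field_simp
        ring
      nlinarith [mul_nonneg hφ0.le (sq_nonneg (u - v))]
    simp only
    rcases le_total 0 (h p.1 ^ 2 - h p.2 ^ 2) with h4 | h4
    · rw [max_eq_left h4, max_eq_right (by linarith)]
      linarith [key (h p.1) (h p.2)]
    · rw [max_eq_right h4, max_eq_left (by linarith)]
      have := key (h p.2) (h p.1)
      have e : (h p.2 - h p.1) ^ 2 = (h p.1 - h p.2) ^ 2 := by ring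
      rw [e] at this
      linarith
  rw [integral_add hpos hpos', integral_add (hiD.const_mul _) (hi12.const_mul _),
    integral_const_mul, integral_const_mul, integral_add hi1 hi2, hE1, hE2] at hmain
  have h5 : φ * ∫ x, h x ^ 2 ∂π ≤ φ⁻¹ * ∫ p, (h p.1 - h p.2) ^ 2 ∂(π ⊗ₘ P) := by linarith
  rw [inv_mul_eq_div, le_div_iff₀ hφ0] at h5
  linarith

lemma dirichlet_form_eq {f : X → ℝ} (hL : MemLp f 2 π) (hm : Measurable f)
    (hrev : P.IsReversible π) :
    ∫ x, f x * (f x - ∫ y, f y ∂(P x)) ∂π = 1 / 2 * ∫ p, (f p.1 - f p.2) ^ 2 ∂(π ⊗ₘ P) := by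
  have hfst := measurePreserving_fst_compProd (π := π) (P := P)
  have hsnd := measurePreserving_snd_compProd (π := π) (P := P) hrev
  have hL1 : MemLp (fun p : X × X => f p.1) 2 (π ⊗ₘ P) := hL.comp_measurePreserving hfst
  have hL2 : MemLp (fun p : X × X => f p.2) 2 (π ⊗ₘ P) := hL.comp_measurePreserving hsnd
  have hi1 : Integrable (fun p : X × X => f p.1 ^ 2) (π ⊗ₘ P) := hL1.integrable_sq
  have hi2 : Integrable (fun p : X × X => f p.2 ^ 2) (π ⊗ₘ P) := hL2.integrable_sq
  have hi12 : Integrable (fun p : X × X => f p.1 * f p.2) (π ⊗ₘ P) := hL1.integrable_mul hL2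
  have hE : ∫ p, f p.2 ^ 2 ∂(π ⊗ₘ P) = ∫ p, f p.1 ^ 2 ∂(π ⊗ₘ P) := by
    conv_rhs => rw [← (measurePreserving_swap_compProd hrev).map_eq]
    rw [integral_map measurable_swap.aemeasurable]
    · rfl
    · exact ((hm.comp measurable_fst).pow_const 2).aestronglyMeasurable
  have e1 : ∫ p, (f p.1 ^ 2 - f p.1 * f p.2) ∂(π ⊗ₘ P) =
      ∫ x, f x * (f x - ∫ y, f y ∂(P x)) ∂π := by
    have hi : Integrable (fun p : X × X => f p.1 ^ 2 - f p.1 * f p.2) (π ⊗ₘ P) := hi1.sub hi12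
    rw [Measure.integral_compProd hi]
    have hae := ((Measure.integrable_compProd_iff (hL2.integrable (by norm_num)).1).1
      (hL2.integrable (by norm_num))).1
    refine integral_congr_ae ?_
    filter_upwards [hae] with x hx
    rw [integral_sub (integrable_const _) (hx.const_mul _), integral_const_mul]
    simp
    ring
  rw [← e1]
  have e2 : ∀ p : X × X, (f p.1 - f p.2) ^ 2 = f p.1 ^ 2 + f p.2 ^ 2 - 2 * (f p.1 * f p.2) :=
    fun p => by ring
  simp_rw [e2]
  have hiA : Integrable (fun p : X × X => f p.1 ^ 2 + f p.2 ^ 2) (π ⊗ₘ P) := hi1.add hi2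
  rw [integral_sub hiA (hi12.const_mul _), integral_add hi1 hi2, integral_const_mul,
    integral_sub hi1 hi12, hE]
  ring

/-- Split `f - m`, with `m` a median, into positive and negative parts. Their Dirichlet energies sum
to at most that of `f`, while their squared norms sum to `∫ f² + m²` because `f` has mean zero. -/
lemma sq_mul_integral_sq_le_of_measurable {φ : ℝ} (hφ0 : 0 < φ) (hrev : P.IsReversible π)
    (hφ : ∀ S, MeasurableSet S → π S ≤ 1 / 2 → ENNReal.ofReal φ * π S ≤ ∫⁻ x in S, P x Sᶜ ∂π)
    {f : X → ℝ} (hm : Measurable f) (hL : MemLp f 2 π) (hmean : ∫ x, f x ∂π = 0) :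
    φ ^ 2 / 2 * ∫ x, f x ^ 2 ∂π ≤ ∫ x, f x * (f x - ∫ y, f y ∂(P x)) ∂π := by
  have : IsProbabilityMeasure (π.map f) := Measure.isProbabilityMeasure_map hm.aemeasurable
  obtain ⟨m, hm1, hm2⟩ := exists_median (π.map f)
  rw [Measure.map_apply hm measurableSet_Ioi] at hm1
  rw [Measure.map_apply hm measurableSet_Iio] at hm2
  have hLm : MemLp (fun x => f x - m) 2 π := hL.sub (memLp_const m)
  have hLm' : MemLp (fun x => -(f x - m)) 2 π := hLm.neg
  have hLp : MemLp (fun x => max (f x - m) 0) 2 π := hLm.pos_part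
  have hLn : MemLp (fun x => max (-(f x - m)) 0) 2 π := hLm'.pos_part
  have hp := sq_mul_integral_sq_le_of_half hφ0 hrev hφ (h := fun x => max (f x - m) 0)
    ((hm.sub_const m).max measurable_const) hLp (fun x => le_max_right _ _) (by
      refine le_trans (measure_mono fun x (hx : 0 < max (f x - m) 0) => ?_) hm1
      have : 0 < f x - m := by simpa using hx
      exact sub_pos.1 this)
  have hn := sq_mul_integral_sq_le_of_half hφ0 hrev hφ (h := fun x => max (-(f x - m)) 0)
    ((hm.sub_const m).neg.max measurable_const) hLn (fun x => le_max_right _ _) (by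
      refine le_trans (measure_mono fun x (hx : 0 < max (-(f x - m)) 0) => ?_) hm2
      have : 0 < -(f x - m) := by
        rcases lt_max_iff.1 hx with h | h
        · exact h
        · exact absurd h (lt_irrefl _)
      exact (by linarith : f x < m))
  have hip := (memLp_comp_sub hLp hrev).integrable_sq
  have hin := (memLp_comp_sub hLn hrev).integrable_sq
  have hif := (memLp_comp_sub hL hrev).integrable_sq
  have hD : ∫ p, (max (f p.1 - m) 0 - max (f p.2 - m) 0) ^ 2 ∂(π ⊗ₘ P) +
      ∫ p, (max (-(f p.1 - m)) 0 - max (-(f p.2 - m)) 0) ^ 2 ∂(π ⊗ₘ P) ≤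
      ∫ p, (f p.1 - f p.2) ^ 2 ∂(π ⊗ₘ P) := by
    rw [← integral_add hip hin]
    refine integral_mono (hip.add hin) hif fun p => ?_
    have key : ∀ u v : ℝ, (max u 0 - max v 0) ^ 2 + (max (-u) 0 - max (-v) 0) ^ 2 ≤
        (u - v) ^ 2 := by
      intro u v
      rcases le_total 0 u with hu | hu <;> rcases le_total 0 v with hv | hv
      · rw [max_eq_left hu, max_eq_left hv, max_eq_right (by linarith), max_eq_right (by linarith)]
        nlinarith
      · rw [max_eq_left hu, max_eq_right hv, max_eq_right (by linarith), max_eq_left (by linarith)]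
        nlinarith
      · rw [max_eq_right hu, max_eq_left hv, max_eq_left (by linarith), max_eq_right (by linarith)]
        nlinarith
      · rw [max_eq_right hu, max_eq_right hv, max_eq_left (by linarith), max_eq_left (by linarith)]
        nlinarith
    refine (key (f p.1 - m) (f p.2 - m)).trans (le_of_eq ?_)
    ring
  have hS : ∫ x, max (f x - m) 0 ^ 2 ∂π + ∫ x, max (-(f x - m)) 0 ^ 2 ∂π =
      ∫ x, (f x ^ 2 + (m ^ 2 - 2 * m * f x)) ∂π := by
    rw [← integral_add hLp.integrable_sq hLn.integrable_sq]
    refine integral_congr_ae (Filter.Eventually.of_forall fun x => ?_)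
    simp only
    rcases le_total 0 (f x - m) with hu | hu
    · rw [max_eq_left hu, max_eq_right (by linarith)]
      ring
    · rw [max_eq_right hu, max_eq_left (by linarith)]
      ring
  have hf1 : Integrable f π := hL.integrable (by norm_num)
  have hf2 : Integrable (fun x => m ^ 2 - 2 * m * f x) π :=
    (integrable_const _).sub (hf1.const_mul _)
  rw [integral_add hL.integrable_sq hf2,
    integral_sub (integrable_const _) (hf1.const_mul _), integral_const_mul, hmean] at hS
  simp only [integral_const, probReal_univ, smul_eq_mul, mul_zero, sub_zero, one_mul] at hS
  rw [dirichlet_form_eq hL hm hrev]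
  nlinarith [mul_nonneg (sq_nonneg φ) (sq_nonneg m)]

/-- Cheeger's inequality. -/
lemma sq_mul_integral_sq_le {φ : ℝ} (hφ0 : 0 < φ) (hrev : P.IsReversible π)
    (hφ : ∀ S, MeasurableSet S → π S ≤ 1 / 2 → ENNReal.ofReal φ * π S ≤ ∫⁻ x in S, P x Sᶜ ∂π)
    {f : X → ℝ} (hL : MemLp f 2 π) (hmean : ∫ x, f x ∂π = 0) :
    φ ^ 2 / 2 * ∫ x, f x ^ 2 ∂π ≤ ∫ x, f x * (f x - ∫ y, f y ∂(P x)) ∂π := by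
  obtain ⟨g, hgm, hfg⟩ := hL.1.aemeasurable
  have hgL : MemLp g 2 π := hL.ae_eq hfg
  have h1 : ∫ x, f x ^ 2 ∂π = ∫ x, g x ^ 2 ∂π :=
    integral_congr_ae (hfg.fun_comp (· ^ 2))
  -- Invariance of `π`: a `π`-null set is `P x`-null for almost every `x`, so the quotient ignores
  -- the choice of version.
  have hPae : ∀ᵐ x ∂π, f =ᵐ[P x] g := by
    have h2 : ∀ᵐ p ∂(π ⊗ₘ P), f p.2 = g p.2 :=
      (measurePreserving_snd_compProd hrev).quasiMeasurePreserving.ae hfg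
    exact Measure.ae_ae_of_ae_compProd h2
  have h3 : ∫ x, f x * (f x - ∫ y, f y ∂(P x)) ∂π = ∫ x, g x * (g x - ∫ y, g y ∂(P x)) ∂π := by
    refine integral_congr_ae ?_
    filter_upwards [hfg, hPae] with x hx hPx
    rw [hx, integral_congr_ae hPx]
  rw [h1, h3]
  exact sq_mul_integral_sq_le_of_measurable hφ0 hrev hφ hgm hgL
    ((integral_congr_ae hfg).symm.trans hmean)

end Cheeger

/-! ### From a spectral gap to decay in total variation. -/

section Contraction

variable {X : Type*} [MeasurableSpace X] {π : Measure X} {P : Kernel X X} [IsMarkovKernel P]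

/-- The kernel `P` acts symmetrically on the bounded functions in `L²(π)`. -/
def IsSymmOp (P : Kernel X X) (π : Measure X) : Prop :=
  ∀ f g : X → ℝ, BddMeasurable f → BddMeasurable g →
    ∫ x, f x * markovOp P g x ∂π = ∫ x, markovOp P f x * g x ∂π

/-- The kernel `P` acts as a positive semidefinite form on the bounded functions in `L²(π)`. -/
def IsPosOp (P : Kernel X X) (π : Measure X) : Prop :=
  ∀ f : X → ℝ, BddMeasurable f → 0 ≤ ∫ x, f x * markovOp P f x ∂π

lemma IsSymmOp.pow (h : IsSymmOp P π) (n : ℕ) : IsSymmOp (P ^ n) π := by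
  induction n with
  | zero =>
    intro f g hf hg
    rw [markovOp_zero_pow P hf, markovOp_zero_pow P hg]
  | succ n ih =>
    intro f g hf hg
    rw [markovOp_pow_succ P n hg, h f _ hf (hg.markovOp _), ih _ g (hf.markovOp _) hg,
      markovOp_pow_succ' P n hf]

/-- By symmetry `⟨f, Pⁿ⁺² f⟩ = ⟨Pf, Pⁿ Pf⟩`, hence induction in steps of two. -/
lemma IsPosOp.pow (hs : IsSymmOp P π) (h : IsPosOp P π) (n : ℕ) : IsPosOp (P ^ n) π := by
  induction n using Nat.twoStepInduction with
  | zero =>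
    intro f hf
    rw [markovOp_zero_pow P hf]
    exact integral_nonneg fun x => mul_self_nonneg _
  | one => rwa [pow_one]
  | more n ih _ =>
    intro f hf
    rw [markovOp_pow_succ P (n + 1) hf, hs f _ hf (hf.markovOp _), markovOp_pow_succ' P n hf]
    exact ih _ (hf.markovOp P)

lemma IsSymmOp.integral_markovOp (h : IsSymmOp P π) {f : X → ℝ} (hf : BddMeasurable f) :
    ∫ x, markovOp P f x ∂π = ∫ x, f x ∂π := by
  have := h (fun _ => 1) f (.const 1) hf
  simpa [markovOp] using this

variable [IsProbabilityMeasure π]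

lemma bddMeasurable_indicator {S : Set X} (hS : MeasurableSet S) :
    BddMeasurable (S.indicator fun _ => (1 : ℝ)) :=
  .of_mem_Icc (measurable_const.indicator hS)
    (fun x => Set.indicator_nonneg (fun _ _ => zero_le_one) x)
    (fun x => Set.indicator_le_self' (fun _ _ => zero_le_one) x)

lemma markovOp_indicator (P : Kernel X X) {S : Set X} (hS : MeasurableSet S) (x : X) :
    markovOp P (S.indicator fun _ => (1 : ℝ)) x = (P x).real S := by
  rw [markovOp, integral_indicator_const _ hS]
  simp

lemma IsSymmOp.isReversible (h : IsSymmOp P π) : P.IsReversible π := by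
  have key : ∀ {A B : Set X}, MeasurableSet A → MeasurableSet B →
      ∫⁻ x in A, P x B ∂π =
        ENNReal.ofReal (∫ x, A.indicator (fun _ => (1 : ℝ)) x *
          markovOp P (B.indicator fun _ => (1 : ℝ)) x ∂π) := by
    intro A B hA hB
    have hb := ((bddMeasurable_indicator hB).markovOp P).integrable (π.restrict A)
    have e : ∫ x, A.indicator (fun _ => (1 : ℝ)) x *
        markovOp P (B.indicator fun _ => (1 : ℝ)) x ∂π =
        ∫ x in A, markovOp P (B.indicator fun _ => (1 : ℝ)) x ∂π := by
      rw [← integral_indicator hA]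
      refine integral_congr_ae (Filter.Eventually.of_forall fun x => ?_)
      by_cases hx : x ∈ A <;> simp [hx]
    rw [e, ofReal_integral_eq_lintegral_ofReal hb (Filter.Eventually.of_forall fun x =>
      markovOp_nonneg P (fun y => Set.indicator_nonneg (fun _ _ => zero_le_one) y) x)]
    refine lintegral_congr fun x => ?_
    rw [markovOp_indicator P hB, ofReal_measureReal]
  intro A B hA hB
  rw [key hA hB, key hB hA, h _ _ (bddMeasurable_indicator hA) (bddMeasurable_indicator hB)]
  simp_rw [mul_comm]

/-- For a positive semidefinite form, the bound `⟨f, Pf⟩ ≤ c ‖f‖²` controls the norm without the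
spectral theorem: expand the form at `f - c⁻¹ Pf` and bound the two diagonal terms, getting `0 ≤ c
‖f‖² - c⁻¹ ‖Pf‖²`. Positivity excludes spectrum near `-1`. -/
lemma integral_markovOp_sq_le (hs : IsSymmOp P π) (hp : IsPosOp P π) {c : ℝ} (hc : 0 < c)
    (hgap : ∀ f : X → ℝ, BddMeasurable f → ∫ x, f x ∂π = 0 →
      ∫ x, f x * markovOp P f x ∂π ≤ c * ∫ x, f x ^ 2 ∂π)
    {f : X → ℝ} (hf : BddMeasurable f) (h0 : ∫ x, f x ∂π = 0) :
    ∫ x, markovOp P f x ^ 2 ∂π ≤ c ^ 2 * ∫ x, f x ^ 2 ∂π := by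
  set g := markovOp P f with hg
  have hgB : BddMeasurable g := hf.markovOp P
  have hPg : BddMeasurable (markovOp P g) := hgB.markovOp P
  have hg0 : ∫ x, g x ∂π = 0 := (hs.integral_markovOp hf).trans h0
  have h1 := hgap f hf h0
  have h2 := hgap g hgB hg0
  have h3 := hp (fun x => f x - c⁻¹ * g x) (hf.sub (hgB.const_mul _))
  have hlin : markovOp P (fun x => f x - c⁻¹ * g x) = fun x => g x - c⁻¹ * markovOp P g x := by
    funext x
    rw [markovOp, integral_sub (hf.integrable _) ((hgB.const_mul _).integrable _),
      integral_const_mul]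
    rfl
  have hsym := hs f g hf hgB
  have e : ∫ x, (f x - c⁻¹ * g x) * (g x - c⁻¹ * markovOp P g x) ∂π =
      ∫ x, f x * g x ∂π - c⁻¹ * ∫ x, g x ^ 2 ∂π - c⁻¹ * ∫ x, f x * markovOp P g x ∂π +
        c⁻¹ ^ 2 * ∫ x, g x * markovOp P g x ∂π := by
    have i1 := hf.mul hgB
    have i2 := (hgB.mul hgB).const_mul c⁻¹
    have i3 := (hf.mul hPg).const_mul c⁻¹
    have i4 := (hgB.mul hPg).const_mul (c⁻¹ ^ 2)
    rw [← integral_const_mul, ← integral_const_mul, ← integral_const_mul]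
    simp_rw [sq (g _)]
    rw [← integral_sub (i1.integrable _) (i2.integrable _),
      ← integral_sub ((i1.sub i2).integrable _) (i3.integrable _),
      ← integral_add (((i1.sub i2).sub i3).integrable _) (i4.integrable _)]
    refine integral_congr_ae (Filter.Eventually.of_forall fun x => ?_)
    simp only
    ring
  rw [hlin, e, hsym] at h3
  have e' : ∫ x, markovOp P f x * g x ∂π = ∫ x, g x ^ 2 ∂π := by
    simp_rw [sq, hg]
  rw [e'] at h3
  set G := ∫ x, g x ^ 2 ∂π
  set F := ∫ x, f x ^ 2 ∂π
  have h4 : c⁻¹ ^ 2 * ∫ x, g x * markovOp P g x ∂π ≤ c⁻¹ * G := by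
    calc c⁻¹ ^ 2 * ∫ x, g x * markovOp P g x ∂π ≤ c⁻¹ ^ 2 * (c * G) :=
          mul_le_mul_of_nonneg_left h2 (by positivity)
      _ = c⁻¹ * G := by field_simp
  have h5 : c⁻¹ * G ≤ c * F := by linarith
  rw [inv_mul_le_iff₀ hc] at h5
  calc G ≤ c * (c * F) := h5
    _ = c ^ 2 * F := by ring

lemma integral_markovOp_pow_sq_le (hs : IsSymmOp P π) (hp : IsPosOp P π) {c : ℝ} (hc : 0 < c)
    (hgap : ∀ f : X → ℝ, BddMeasurable f → ∫ x, f x ∂π = 0 →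
      ∫ x, f x * markovOp P f x ∂π ≤ c * ∫ x, f x ^ 2 ∂π)
    {f : X → ℝ} (hf : BddMeasurable f) (h0 : ∫ x, f x ∂π = 0) (n : ℕ) :
    ∫ x, markovOp (P ^ n) f x ^ 2 ∂π ≤ (c ^ n) ^ 2 * ∫ x, f x ^ 2 ∂π := by
  induction n with
  | zero => rw [markovOp_zero_pow P hf]; simp
  | succ n ih =>
    rw [markovOp_pow_succ P n hf]
    refine (integral_markovOp_sq_le hs hp hc hgap (hf.markovOp _)
      (((hs.pow n).integral_markovOp hf).trans h0)).trans ?_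
    calc c ^ 2 * ∫ x, markovOp (P ^ n) f x ^ 2 ∂π
        ≤ c ^ 2 * ((c ^ n) ^ 2 * ∫ x, f x ^ 2 ∂π) := mul_le_mul_of_nonneg_left ih (by positivity)
      _ = _ := by ring

/-- A centred indicator has variance at most `1 / 4`, whence the factor `1 / 2`. The warm start
enters through `(∫ u dμ)² ≤ ∫ u² dμ ≤ Ω ∫ u² dπ`. -/
lemma tvDist_bind_pow_le (hs : IsSymmOp P π) (hp : IsPosOp P π) {c : ℝ} (hc : 0 < c)
    (hgap : ∀ f : X → ℝ, BddMeasurable f → ∫ x, f x ∂π = 0 →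
      ∫ x, f x * markovOp P f x ∂π ≤ c * ∫ x, f x ^ 2 ∂π)
    (μ : Measure X) [IsProbabilityMeasure μ] {Ω : ℝ} (hΩ : 0 < Ω) (hμ : IsWarmStart μ π Ω)
    (n : ℕ) : tvDist (μ.bind ⇑(P ^ n)) π ≤ c ^ n * (Real.sqrt Ω / 2) := by
  refine tvDist_le fun S hS => ?_
  set s := π.real S with hsdef
  have hI := bddMeasurable_indicator hS
  have hs0 : ∫ x, S.indicator (fun _ => (1 : ℝ)) x ∂π = s := by
    rw [integral_indicator_const _ hS]
    simp [hsdef]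
  set f : X → ℝ := fun x => S.indicator (fun _ => (1 : ℝ)) x - s with hfdef
  have hf : BddMeasurable f := hI.sub (.const s)
  have hf0 : ∫ x, f x ∂π = 0 := by
    rw [integral_sub (hI.integrable _) (integrable_const _), hs0]
    simp
  have hf2 : ∫ x, f x ^ 2 ∂π ≤ 1 / 4 := by
    have e : ∀ x, f x ^ 2 = (1 - 2 * s) * S.indicator (fun _ => (1 : ℝ)) x + s ^ 2 := by
      intro x
      by_cases hx : x ∈ S <;> simp [hfdef, hx]
      ring
    simp_rw [e]
    rw [integral_add ((hI.integrable _).const_mul _) (integrable_const _), integral_const_mul, hs0]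
    simp only [integral_const, probReal_univ, one_smul]
    nlinarith [sq_nonneg (s - 1 / 2)]
  set u := markovOp (P ^ n) f with hu
  have huB : BddMeasurable u := hf.markovOp _
  have e1 : (μ.bind ⇑(P ^ n)).real S - s = ∫ x, u x ∂μ := by
    have hux : ∀ x, u x = ((P ^ n) x).real S - s := by
      intro x
      rw [hu, markovOp, hfdef, integral_sub (hI.integrable _) (integrable_const _),
        ← markovOp_indicator (P ^ n) hS x]
      simp [markovOp]
    have hb : BddMeasurable fun x => ((P ^ n) x).real S := by
      have := hI.markovOp (P ^ n)
      simpa only [funext (markovOp_indicator (P ^ n) hS)] using this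
    simp_rw [hux]
    rw [integral_sub (hb.integrable _) (integrable_const _)]
    simp only [integral_const, probReal_univ, one_smul]
    congr 1
    rw [measureReal_def, Measure.bind_apply hS (Kernel.aemeasurable _)]
    simp_rw [measureReal_def]
    rw [integral_toReal ((P ^ n).measurable_coe hS).aemeasurable
      (Filter.Eventually.of_forall fun x => measure_lt_top _ _)]
  rw [e1]
  refine abs_le_of_sq_le_sq ?_ (by positivity)
  have hu2 := huB.mul huB
  have e2 : (∫ x, u x ∂μ) ^ 2 ≤ ∫ x, u x ^ 2 ∂μ := by
    set a := ∫ x, u x ∂μ with ha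
    have h1 : 0 ≤ ∫ x, (u x - a) ^ 2 ∂μ := integral_nonneg fun x => sq_nonneg _
    have e : ∀ x, (u x - a) ^ 2 = u x * u x - 2 * a * u x + a ^ 2 := fun x => by ring
    simp_rw [e] at h1
    rw [integral_add ((hu2.sub (huB.const_mul _)).integrable _) (integrable_const _),
      integral_sub (hu2.integrable _) ((huB.integrable _).const_mul _), integral_const_mul,
      ← ha] at h1
    simp only [integral_const, probReal_univ, one_smul] at h1
    simp_rw [sq (u _)]
    linarith
  have hle : μ ≤ ENNReal.ofReal Ω • π := Measure.le_intro fun A hA _ => by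
    simpa using hμ A hA
  have e3 : ∫ x, u x ^ 2 ∂μ ≤ Ω * ∫ x, u x ^ 2 ∂π := by
    have := integral_mono_measure hle (f := fun x => u x ^ 2)
      (Filter.Eventually.of_forall fun x => sq_nonneg _) (by
        simp_rw [sq]
        exact (hu2.integrable π).smul_measure (by simp))
    rwa [integral_smul_measure, ENNReal.toReal_ofReal hΩ.le, smul_eq_mul] at this
  have e4 := integral_markovOp_pow_sq_le hs hp hc hgap hf hf0 n
  calc (∫ x, u x ∂μ) ^ 2 ≤ Ω * ∫ x, u x ^ 2 ∂π := e2.trans e3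
    _ ≤ Ω * ((c ^ n) ^ 2 * (1 / 4)) :=
        mul_le_mul_of_nonneg_left (e4.trans (mul_le_mul_of_nonneg_left hf2 (by positivity))) hΩ.le
    _ = (c ^ n * (Real.sqrt Ω / 2)) ^ 2 := by
        rw [mul_pow, div_pow, Real.sq_sqrt hΩ.le]
        ring

end Contraction

/-! ### Symmetry and positivity of the random scan. -/

section GibbsOperator

variable {d : ℕ}

/-- The vector with `k`-th coordinate `p.2` and remaining coordinates `p.1`. -/
noncomputable def mergeCoord (k : Fin d) (p : EuclideanSpace ℝ {j : Fin d // j ≠ k} × ℝ) :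
    EuclideanSpace ℝ (Fin d) :=
  WithLp.toLp 2 fun j => if h : j = k then p.2 else p.1 ⟨j, h⟩

lemma measurable_mergeCoord (k : Fin d) : Measurable (mergeCoord k) := by
  refine (WithLp.measurable_toLp 2 _).comp (measurable_pi_lambda _ fun j => ?_)
  by_cases h : j = k
  · simpa [h] using measurable_snd
  · simp only [h, dif_neg, not_false_eq_true]
    fun_prop

lemma setCoord_eq_mergeCoord (k : Fin d) (x : EuclideanSpace ℝ (Fin d)) (t : ℝ) :
    setCoord k x t = mergeCoord k (dropCoord k x, t) := by
  ext j
  rw [setCoord_apply]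
  by_cases h : j = k <;> simp [mergeCoord, dropCoord, h]

lemma mergeCoord_dropCoord (k : Fin d) (x : EuclideanSpace ℝ (Fin d)) :
    mergeCoord k (dropCoord k x, x k) = x := by
  ext j
  by_cases h : j = k
  · subst h; simp [mergeCoord]
  · simp [mergeCoord, dropCoord, h]

variable {π : Measure (EuclideanSpace ℝ (Fin d))} [IsProbabilityMeasure π]

/-- The kernel `P_k` is conditional expectation given `x_{-k}`. The right side is visibly symmetric
in `f` and `g`, and the integral of a square when `f = g`. -/
lemma integral_mul_markovOp_coordKernel {k : Fin d}
    {κ : Kernel (EuclideanSpace ℝ {j : Fin d // j ≠ k}) ℝ} [IsMarkovKernel κ]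
    (hκ : HasCondDistrib (fun x : EuclideanSpace ℝ (Fin d) => x k) (dropCoord k) κ π)
    {f g : EuclideanSpace ℝ (Fin d) → ℝ} (hf : BddMeasurable f) (hg : BddMeasurable g) :
    ∫ x, f x * markovOp (coordKernel k κ) g x ∂π =
      ∫ z, (∫ t, f (mergeCoord k (z, t)) ∂κ z) * (∫ t, g (mergeCoord k (z, t)) ∂κ z)
        ∂(π.map (dropCoord k)) := by
  have hdrop := measurable_dropCoord k
  have : IsProbabilityMeasure (π.map (dropCoord k)) :=
    Measure.isProbabilityMeasure_map hdrop.aemeasurable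
  have hgm := hg.comp (measurable_mergeCoord k)
  have hG : BddMeasurable fun z => ∫ t, g (mergeCoord k (z, t)) ∂κ z := by
    obtain ⟨B, hB⟩ := hg.bdd
    refine ⟨(hgm.measurable.stronglyMeasurable.integral_kernel_prod_right'
      (κ := κ)).measurable, B, fun z => ?_⟩
    have := norm_integral_le_of_norm_le_const (μ := κ z) (f := fun t => g (mergeCoord k (z, t)))
      (C := B) (Filter.Eventually.of_forall fun y => by simpa using hB _)
    simpa using this
  set H : EuclideanSpace ℝ {j : Fin d // j ≠ k} × ℝ → ℝ := fun p =>
    f (mergeCoord k p) * ∫ t, g (mergeCoord k (p.1, t)) ∂κ p.1 with hHdef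
  have hH : BddMeasurable H := (hf.comp (measurable_mergeCoord k)).mul (hG.comp measurable_fst)
  have e1 : ∀ x, f x * markovOp (coordKernel k κ) g x = H (dropCoord k x, x k) := by
    intro x
    rw [markovOp_coordKernel k κ hg, hHdef]
    simp only [mergeCoord_dropCoord, setCoord_eq_mergeCoord]
  simp_rw [e1]
  have hmeas : Measurable fun x : EuclideanSpace ℝ (Fin d) => (dropCoord k x, x k) :=
    hdrop.prodMk (by fun_prop)
  rw [← integral_map (f := H) hmeas.aemeasurable hH.measurable.aestronglyMeasurable, hκ.map_eq,
    Measure.integral_compProd (hH.integrable _)]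
  refine integral_congr_ae (Filter.Eventually.of_forall fun z => ?_)
  simp only [hHdef]
  rw [integral_mul_const]

variable {κ : (k : Fin d) → Kernel (EuclideanSpace ℝ {j : Fin d // j ≠ k}) ℝ}
  [∀ k, IsMarkovKernel (κ k)]

lemma integral_mul_markovOp_randomScan {f g : EuclideanSpace ℝ (Fin d) → ℝ}
    (hf : BddMeasurable f) (hg : BddMeasurable g) :
    ∫ x, f x * markovOp (randomScan κ) g x ∂π =
      (d : ℝ)⁻¹ * ∑ k, ∫ x, f x * markovOp (coordKernel k (κ k)) g x ∂π := by
  rw [← integral_finsetSum _ fun k _ => (hf.mul (hg.markovOp _)).integrable _,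
    ← integral_const_mul]
  refine integral_congr_ae (Filter.Eventually.of_forall fun x => ?_)
  simp only
  rw [markovOp_randomScan κ hg, ← Finset.mul_sum]
  ring

lemma isSymmOp_randomScan (hκ : IsFullConditional π κ) : IsSymmOp (randomScan κ) π := by
  intro f g hf hg
  have : ∫ x, markovOp (randomScan κ) f x * g x ∂π = ∫ x, g x * markovOp (randomScan κ) f x ∂π := by
    simp_rw [mul_comm]
  rw [this, integral_mul_markovOp_randomScan hf hg, integral_mul_markovOp_randomScan hg hf]
  congr 1
  refine Finset.sum_congr rfl fun k _ => ?_
  rw [integral_mul_markovOp_coordKernel (hκ k) hf hg, integral_mul_markovOp_coordKernel (hκ k) hg hf]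
  simp_rw [mul_comm]

lemma isPosOp_randomScan (hκ : IsFullConditional π κ) : IsPosOp (randomScan κ) π := by
  intro f hf
  rw [integral_mul_markovOp_randomScan hf hf]
  refine mul_nonneg (by positivity) (Finset.sum_nonneg fun k _ => ?_)
  rw [integral_mul_markovOp_coordKernel (hκ k) hf hf]
  exact integral_nonneg fun z => mul_self_nonneg _

end GibbsOperator

/-! ### Smooth separating functions. -/

section Mollification

variable {E : Type*} [NormedAddCommGroup E] [NormedSpace ℝ E] [FiniteDimensional ℝ E]

/-- A bounded Lipschitz function has a smooth approximation with the same Lipschitz constant that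
agrees with it wherever it is constant on a ball of radius `ε`. -/
lemma exists_contDiff_lipschitz_eq_of_const_on_ball {g : E → ℝ} {K : ℝ≥0} (hg : LipschitzWith K g)
    {B : ℝ} (hB : ∀ x y, dist (g x) (g y) ≤ B) {ε : ℝ} (hε : 0 < ε) :
    ∃ f : E → ℝ, ContDiff ℝ 1 f ∧ LipschitzWith K f ∧ (∀ x, dist (f x) (g x) ≤ B) ∧
      ∀ x, (∀ y ∈ Metric.ball x ε, g y = g x) → f x = g x := by
  borelize E
  let φ : ContDiffBump (0 : E) := ⟨ε / 2, ε, half_pos hε, half_lt_self hε⟩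
  let μ : Measure E := Measure.addHaar
  have hgc : Continuous g := hg.continuous
  have hex : ConvolutionExists (φ.normed μ) g (ContinuousLinearMap.lsmul ℝ ℝ) μ :=
    φ.hasCompactSupport_normed.convolutionExists_left_of_continuous_right _
      φ.continuous_normed.locallyIntegrable hgc
  refine ⟨convolution (φ.normed μ) g (ContinuousLinearMap.lsmul ℝ ℝ) μ, ?_, ?_, ?_, ?_⟩
  · exact φ.hasCompactSupport_normed.contDiff_convolution_left _ (n := 1)
      (φ.contDiff_normed (n := 1)) hgc.locallyIntegrable
  · refine LipschitzWith.of_dist_le_mul fun x y => ?_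
    have hx := (hex x).integrable
    have hy := (hex y).integrable
    simp only [convolution_def]
    rw [Real.dist_eq, ← integral_sub hx hy, ← Real.norm_eq_abs]
    have := norm_integral_le_of_norm_le (μ := μ)
      (f := fun t => (ContinuousLinearMap.lsmul ℝ ℝ) (φ.normed μ t) (g (x - t)) -
        (ContinuousLinearMap.lsmul ℝ ℝ) (φ.normed μ t) (g (y - t)))
      (g := fun t => φ.normed μ t * (K * dist x y))
      (φ.integrable_normed.mul_const _) (Filter.Eventually.of_forall fun t => by
        rw [← map_sub]
        simp only [ContinuousLinearMap.lsmul_apply, smul_eq_mul]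
        rw [norm_mul, Real.norm_of_nonneg (φ.nonneg_normed t), ← dist_eq_norm]
        refine mul_le_mul_of_nonneg_left ?_ (φ.nonneg_normed t)
        simpa using hg.dist_le_mul (x - t) (y - t))
    rwa [integral_mul_const, φ.integral_normed, one_mul] at this
  · exact fun x => ContDiffBump.dist_normed_convolution_le hgc.aestronglyMeasurable
      fun y _ => hB y x
  · exact fun x hx => ContDiffBump.normed_convolution_eq_right hx

/-- Two sets at distance at least `δ > r` can be separated by a smooth `1 / r`-Lipschitz function
whose derivative vanishes on both sets. -/
lemma exists_contDiff_separating {A B : Set E} (hA : A.Nonempty) {r δ : ℝ} (hr : 0 < r)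
    (hrδ : r < δ) (hAB : ∀ x ∈ A, ∀ y ∈ B, δ ≤ dist x y) :
    ∃ f : E → ℝ, ContDiff ℝ 1 f ∧ LipschitzWith (Real.toNNReal (1 / r)) f ∧ (∀ x, |f x| ≤ 2) ∧
      (∀ x ∈ A, f x = 0 ∧ fderiv ℝ f x = 0) ∧ (∀ x ∈ B, f x = 1 ∧ fderiv ℝ f x = 0) := by
  -- The ramp of width `r` sits in the middle of the gap, leaving a margin `η` on both sides where
  -- `g` is constant. Mollifying at scale below `η` then keeps the values on `A` and `B`, and yields
  -- a gradient everywhere, as needed when `π` has no density.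
  set η := (δ - r) / 2 with hη
  have hη0 : 0 < η := by linarith
  set g : E → ℝ := fun x => max 0 (min 1 ((Metric.infDist x A - η) / r)) with hgdef
  have hg0 : ∀ x, 0 ≤ g x := fun x => le_max_left _ _
  have hg1 : ∀ x, g x ≤ 1 := fun x => max_le zero_le_one (min_le_left _ _)
  have hgL : LipschitzWith (Real.toNNReal (1 / r)) g := by
    have h1 : LipschitzWith (Real.toNNReal (1 / r)) fun x => (Metric.infDist x A - η) / r := by
      refine LipschitzWith.of_dist_le_mul fun x y => ?_
      rw [Real.dist_eq, Real.coe_toNNReal _ (by positivity), ← sub_div, abs_div, abs_of_pos hr,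
        sub_sub_sub_cancel_right, one_div, inv_mul_eq_div]
      have := (Metric.lipschitz_infDist_pt A).dist_le_mul x y
      rw [Real.dist_eq, NNReal.coe_one, one_mul] at this
      gcongr
    exact (h1.const_min 1).const_max 0
  have hgA : ∀ x ∈ A, ∀ y, dist y x < η → g y = 0 := by
    intro x hx y hy
    refine max_eq_left ((min_le_right _ _).trans (div_nonpos_of_nonpos_of_nonneg ?_ hr.le))
    have := Metric.infDist_le_dist_of_mem (x := y) hx
    linarith
  have hgB : ∀ x ∈ B, ∀ y, dist y x < η → g y = 1 := by
    intro x hx y hy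
    have h1 : δ ≤ Metric.infDist x A :=
      (Metric.le_infDist hA).2 fun z hz => by rw [dist_comm]; exact hAB z hz x hx
    have h2 := Metric.infDist_le_infDist_add_dist (s := A) (x := x) (y := y)
    rw [dist_comm] at h2
    have h3 : 1 ≤ (Metric.infDist y A - η) / r := by
      rw [one_le_div hr]
      linarith
    simp only [hgdef]
    rw [min_eq_left h3, max_eq_right zero_le_one]
  obtain ⟨f, hfs, hfL, hfg, hfc⟩ := exists_contDiff_lipschitz_eq_of_const_on_ball hgL (B := 1)
    (fun x y => by
      rw [Real.dist_eq]
      exact abs_le.2 ⟨by linarith [hg0 x, hg1 y], by linarith [hg1 x, hg0 y]⟩) (half_pos hη0)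
  have key : ∀ (x : E) (c : ℝ), (∀ y, dist y x < η → g y = c) → f x = c ∧ fderiv ℝ f x = 0 := by
    intro x c hc
    have hloc : ∀ y ∈ Metric.ball x (η / 2), f y = c := by
      intro y hy
      rw [Metric.mem_ball] at hy
      rw [hfc y, hc y (by linarith)]
      intro z hz
      rw [Metric.mem_ball] at hz
      rw [hc y (by linarith), hc z (by linarith [dist_triangle z y x])]
    refine ⟨hloc x (Metric.mem_ball_self (half_pos hη0)), ?_⟩
    have : f =ᶠ[nhds x] fun _ => c := by
      filter_upwards [Metric.ball_mem_nhds x (half_pos hη0)] with y hy using hloc y hy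
    rw [this.fderiv_eq]
    simp
  refine ⟨f, hfs, hfL, fun x => ?_, fun x hx => key x 0 (hgA x hx), fun x hx => key x 1 (hgB x hx)⟩
  have := hfg x
  rw [Real.dist_eq, abs_le] at this
  exact abs_le.2 ⟨by linarith [hg0 x, this.1], by linarith [hg1 x, this.2]⟩

end Mollification

/-! ### Isoperimetry and the conductance bound. -/

section Isoperimetry

variable {d : ℕ} {π : Measure (EuclideanSpace ℝ (Fin d))} [IsProbabilityMeasure π]

/-- The `L^q`-Poincaré inequality implies a three-set isoperimetric inequality. -/
lemma SatisfiesPoincare.three_set {q C : ℝ} (hq : 1 ≤ q) (hC : 0 < C)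
    (hπ : SatisfiesPoincare π q C) {r δ : ℝ} (hr : 0 < r) (hrδ : r < δ)
    {A B : Set (EuclideanSpace ℝ (Fin d))} (hA : MeasurableSet A) (hB : MeasurableSet B)
    (hAB : ∀ x ∈ A, ∀ y ∈ B, δ ≤ dist x y) :
    2 * (C * (r / 2) ^ q) * min (π.real A) (π.real B) ≤ π.real (A ∪ B)ᶜ := by
  rcases A.eq_empty_or_nonempty with rfl | hne
  · simp
  have hq0 : 0 ≤ q := by linarith
  obtain ⟨f, hfs, hfL, hfb, hfA, hfB⟩ := exists_contDiff_separating hne hr hrδ hAB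
  have hfm : Measurable f := hfs.continuous.measurable
  have hdiff : Differentiable ℝ f := hfs.differentiable (by norm_num)
  have hP := hπ f hfL.locallyLipschitz ((⟨hfm, 2, hfb⟩ : BddMeasurable f).integrable π)
    (Filter.Eventually.of_forall fun x => hdiff x)
  set m := ∫ y, f y ∂π
  have hdisj : Disjoint A B := by
    refine Set.disjoint_left.2 fun x hxA hxB => ?_
    have := hAB x hxA x hxB
    rw [dist_self] at this
    linarith
  set p := min (π A) (π B) with hp
  have hlow : p * (‖m‖ₑ ^ q + ‖1 - m‖ₑ ^ q) ≤ ∫⁻ x, ‖f x - m‖ₑ ^ q ∂π := by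
    calc p * (‖m‖ₑ ^ q + ‖1 - m‖ₑ ^ q) ≤ ‖m‖ₑ ^ q * π A + ‖1 - m‖ₑ ^ q * π B := by
          rw [mul_add, mul_comm p, mul_comm p]
          gcongr
          · exact min_le_left _ _
          · exact min_le_right _ _
      _ = ∫⁻ x in A, ‖f x - m‖ₑ ^ q ∂π + ∫⁻ x in B, ‖f x - m‖ₑ ^ q ∂π := by
          rw [← setLIntegral_const, ← setLIntegral_const]
          congr 1
          · refine setLIntegral_congr_fun hA fun x hx => ?_
            rw [(hfA x hx).1, zero_sub, enorm_neg]
          · refine setLIntegral_congr_fun hB fun x hx => ?_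
            rw [(hfB x hx).1]
      _ = ∫⁻ x in A ∪ B, ‖f x - m‖ₑ ^ q ∂π := (lintegral_union hB hdisj).symm
      _ ≤ _ := setLIntegral_le_lintegral _ _
  have hup : ∫⁻ x, ‖gradient f x‖ₑ ^ q ∂π ≤ ENNReal.ofReal (1 / r) ^ q * π (A ∪ B)ᶜ := by
    have hnorm : ∀ x, ‖gradient f x‖ = ‖fderiv ℝ f x‖ := fun x =>
      LinearIsometryEquiv.norm_map _ _
    rw [← setLIntegral_const, ← lintegral_indicator (hA.union hB).compl]
    refine lintegral_mono fun x => ?_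
    by_cases hx : x ∈ A ∪ B
    · have h0 : fderiv ℝ f x = 0 := hx.elim (fun h => (hfA x h).2) (fun h => (hfB x h).2)
      have h1 : gradient f x = 0 := norm_eq_zero.1 (by rw [hnorm, h0, norm_zero])
      simp [h1, show 0 < q by linarith]
    · rw [Set.indicator_of_mem (show x ∈ (A ∪ B)ᶜ from hx)]
      refine ENNReal.rpow_le_rpow ?_ hq0
      rw [← ofReal_norm, hnorm]
      refine ENNReal.ofReal_le_ofReal ((norm_fderiv_le_of_lipschitz ℝ hfL).trans (le_of_eq ?_))
      exact Real.coe_toNNReal _ (by positivity)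
  -- Convexity of the `q`-th power bounds the deviation from below whatever the mean `m` is.
  have hone : (1 : ℝ≥0∞) ≤ 2 ^ (q - 1) * (‖m‖ₑ ^ q + ‖1 - m‖ₑ ^ q) := by
    have h1 : (1 : ℝ≥0∞) ≤ ‖m‖ₑ + ‖1 - m‖ₑ := by
      have := enorm_add_le m (1 - m)
      rw [add_sub_cancel] at this
      simpa using this
    calc (1 : ℝ≥0∞) = 1 ^ q := (ENNReal.one_rpow q).symm
      _ ≤ (‖m‖ₑ + ‖1 - m‖ₑ) ^ q := ENNReal.rpow_le_rpow h1 hq0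
      _ ≤ _ := ENNReal.rpow_add_le_mul_rpow_add_rpow _ _ hq
  have hfin : p ≤ 2 ^ (q - 1) *
      (ENNReal.ofReal (1 / C) * (ENNReal.ofReal (1 / r) ^ q * π (A ∪ B)ᶜ)) := by
    calc p ≤ p * (2 ^ (q - 1) * (‖m‖ₑ ^ q + ‖1 - m‖ₑ ^ q)) := le_mul_of_one_le_right' hone
      _ = 2 ^ (q - 1) * (p * (‖m‖ₑ ^ q + ‖1 - m‖ₑ ^ q)) := by ring
      _ ≤ _ := mul_le_mul_right (hlow.trans (hP.trans (mul_le_mul_right hup _))) _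
  have hreal : min (π.real A) (π.real B) ≤
      2 ^ (q - 1) * (1 / C * ((1 / r) ^ q * π.real (A ∪ B)ᶜ)) := by
    have h2 : (2 : ℝ≥0∞) ^ (q - 1) = ENNReal.ofReal (2 ^ (q - 1)) := by
      rw [← ENNReal.ofReal_rpow_of_pos (by norm_num)]
      simp
    have h3 : p = ENNReal.ofReal (min (π.real A) (π.real B)) := by
      rw [ENNReal.ofReal_min, ofReal_measureReal, ofReal_measureReal]
    rw [h2, h3, ENNReal.ofReal_rpow_of_pos (by positivity), ← ofReal_measureReal (μ := π),
      ← ENNReal.ofReal_mul (by positivity), ← ENNReal.ofReal_mul (by positivity),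
      ← ENNReal.ofReal_mul (by positivity)] at hfin
    exact (ENNReal.ofReal_le_ofReal_iff (by positivity)).1 hfin
  have h2q : (2 : ℝ) ^ (q - 1) = 2 ^ q / 2 := by rw [Real.rpow_sub_one (by norm_num)]
  rw [h2q, Real.div_rpow zero_le_one hr.le, Real.one_rpow] at hreal
  rw [Real.div_rpow hr.le (by norm_num)]
  have h2 : (0 : ℝ) < 2 ^ q := by positivity
  have h3 : 0 < r ^ q := by positivity
  calc 2 * (C * (r ^ q / 2 ^ q)) * min (π.real A) (π.real B)
      ≤ 2 * (C * (r ^ q / 2 ^ q)) *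
        (2 ^ q / 2 * (1 / C * (1 / r ^ q * π.real (A ∪ B)ᶜ))) :=
          mul_le_mul_of_nonneg_left hreal (by positivity)
    _ = π.real (A ∪ B)ᶜ := by field_simp

/-- Conductance bound from isoperimetry and overlap of nearby one-step laws. -/
lemma conductance_lower_bound {q C : ℝ} (hq : 1 ≤ q) (hC : 0 < C)
    (hπ : SatisfiesPoincare π q C) {r δ : ℝ} (hr : 0 < r) (hrδ : r < δ)
    {P : Kernel (EuclideanSpace ℝ (Fin d)) (EuclideanSpace ℝ (Fin d))} [IsMarkovKernel P]
    (hrev : P.IsReversible π)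
    (hover : ∀ S, MeasurableSet S → ∀ x y, dist x y ≤ δ → (P x).real S - (P y).real S ≤ 15 / 16)
    {S : Set (EuclideanSpace ℝ (Fin d))} (hS : MeasurableSet S) (hS2 : π S ≤ 1 / 2) :
    ENNReal.ofReal (1 / 64 * min 1 (C * (r / 2) ^ q)) * π S ≤ ∫⁻ x in S, P x Sᶜ ∂π := by
  -- Half of `1 - 15 / 16`: points staying on opposite sides with probability above `1 - ε` violate
  -- the overlap bound.
  set ε : ℝ≥0∞ := ENNReal.ofReal (1 / 32) with hε
  have hmeas : ∀ {T : Set (EuclideanSpace ℝ (Fin d))}, MeasurableSet T →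
      MeasurableSet {x | ε ≤ P x T} := fun {T} hT =>
    measurableSet_le measurable_const (P.measurable_coe hT)
  set G := {x | ε ≤ P x Sᶜ} with hG
  set G' := {x | ε ≤ P x S} with hG'
  have hGm : MeasurableSet G := hmeas hS.compl
  have hGm' : MeasurableSet G' := hmeas hS
  have hflow : ∫⁻ x in S, P x Sᶜ ∂π ≠ ∞ := by
    refine ne_top_of_le_ne_top (measure_ne_top π S) ?_
    calc ∫⁻ x in S, P x Sᶜ ∂π ≤ ∫⁻ _ in S, 1 ∂π := lintegral_mono fun x => prob_le_one
      _ = π S := by simp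
  set F := (∫⁻ x in S, P x Sᶜ ∂π).toReal with hF
  have hm1 : 1 / 32 * π.real (S ∩ G) ≤ F := by
    have := mul_meas_ge_le_lintegral (μ := π.restrict S) (P.measurable_coe hS.compl) ε
    rw [Measure.restrict_apply hGm, Set.inter_comm] at this
    have := ENNReal.toReal_mono hflow this
    rwa [ENNReal.toReal_mul, ENNReal.toReal_ofReal (by norm_num)] at this
  have hm2 : 1 / 32 * π.real (Sᶜ ∩ G') ≤ F := by
    have := mul_meas_ge_le_lintegral (μ := π.restrict Sᶜ) (P.measurable_coe hS) ε
    rw [Measure.restrict_apply hGm', Set.inter_comm, ← hrev hS hS.compl] at this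
    have := ENNReal.toReal_mono hflow this
    rwa [ENNReal.toReal_mul, ENNReal.toReal_ofReal (by norm_num)] at this
  have hs : π.real S ≤ 1 / 2 := by
    have := ENNReal.toReal_mono (by simp) hS2
    simpa [measureReal_def] using this
  have hcompl : π.real Sᶜ = 1 - π.real S := by
    rw [measureReal_compl hS, probReal_univ]
  have hsplit1 : π.real (S \ G) + π.real (S ∩ G) = π.real S := by
    rw [add_comm]; exact measureReal_inter_add_sdiff hGm
  have hsplit2 : π.real (Sᶜ \ G') + π.real (Sᶜ ∩ G') = π.real Sᶜ := by
    rw [add_comm]; exact measureReal_inter_add_sdiff hGm'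
  have hdist : ∀ x ∈ S \ G, ∀ y ∈ Sᶜ \ G', δ ≤ dist x y := by
    intro x hx y hy
    by_contra hxy
    have h1 := hover S hS x y (not_le.1 hxy).le
    have hlt : ∀ (z : EuclideanSpace ℝ (Fin d)) (T : Set (EuclideanSpace ℝ (Fin d))),
        ¬ ε ≤ P z T → (P z).real T < 1 / 32 := by
      intro z T h
      have := (ENNReal.toReal_lt_toReal (measure_ne_top _ _) (by simp [hε])).2 (not_le.1 h)
      rwa [hε, ENNReal.toReal_ofReal (by norm_num)] at this
    have h2 := hlt x Sᶜ hx.2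
    have h3 := hlt y S hy.2
    rw [measureReal_compl hS, probReal_univ] at h2
    linarith
  have hiso := hπ.three_set hq hC hr hrδ (hS.diff hGm) (hS.compl.diff hGm') hdist
  have hD : ((S \ G) ∪ (Sᶜ \ G'))ᶜ = (S ∩ G) ∪ (Sᶜ ∩ G') := by
    ext x
    by_cases h : x ∈ S <;> simp [h]
  rw [hD] at hiso
  have hun := measureReal_union_le (μ := π) (S ∩ G) (Sᶜ ∩ G')
  rw [← ofReal_measureReal (μ := π) (s := S), ← ENNReal.ofReal_toReal hflow, ← hF,
    ← ENNReal.ofReal_mul (by positivity)]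
  refine ENNReal.ofReal_le_ofReal ?_
  set K := C * (r / 2) ^ q
  have hK : 0 ≤ K := by positivity
  have hs0 : 0 ≤ π.real S := measureReal_nonneg
  have hmin1 : min 1 K * π.real S ≤ π.real S := mul_le_of_le_one_left hs0 (min_le_left _ _)
  have hmin2 : min 1 K * π.real S ≤ K * π.real S :=
    mul_le_mul_of_nonneg_right (min_le_right _ _) hs0
  rw [mul_assoc]
  -- If either sticky set has mass below `π(S) / 2`, the flow bound `hm1` or `hm2` suffices, using
  -- `π(S) ≤ π(Sᶜ)` for the latter. Otherwise the three-set inequality applies, and adding `hm1` and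
  -- `hm2` gives the constant `1 / 64`.
  by_cases h1 : π.real (S \ G) < π.real S / 2
  · linarith
  by_cases h2 : π.real (Sᶜ \ G') < π.real S / 2
  · linarith
  have h3 : π.real S / 2 ≤ min (π.real (S \ G)) (π.real (Sᶜ \ G')) :=
    le_min (not_lt.1 h1) (not_lt.1 h2)
  have h4 := mul_le_mul_of_nonneg_left h3 (by positivity : 0 ≤ 2 * K)
  have h5 : 2 * K * (π.real S / 2) = K * π.real S := by ring
  rw [h5] at h4
  linarith

end Isoperimetry

/-! ### Bounds on conductance, gap and mixing time. -/

section Chains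

variable {X : Type*} [MeasurableSpace X] {π : Measure X} {P : Kernel X X}

lemma le_conductance [IsFiniteMeasure π] {φ : ℝ≥0∞}
    (hφ : ∀ S, MeasurableSet S → π S ≤ 1 / 2 → φ * π S ≤ ∫⁻ x in S, P x Sᶜ ∂π) :
    φ ≤ conductance π P := by
  refine le_iInf fun S => le_iInf fun hS => le_iInf fun h0 => le_iInf fun h2 => ?_
  exact (ENNReal.le_div_iff_mul_le (Or.inl h0.ne') (Or.inl (measure_ne_top _ _))).2 (hφ S hS h2)

lemma mixingTime_le_of_tvDist_le {μ : Measure X} {ζ b : ℝ} {n : ℕ}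
    (h : tvDist (μ.bind ⇑(P ^ n)) π ≤ ζ) (hn : (n : ℝ) ≤ b) :
    (mixingTime μ π P ζ : ℝ≥0∞) ≤ ENNReal.ofReal b := by
  have h1 : mixingTime μ π P ζ ≤ (n : ℕ∞) := iInf₂_le n h
  calc (mixingTime μ π P ζ : ℝ≥0∞) ≤ ((n : ℕ∞) : ℝ≥0∞) := ENat.toENNReal_le.2 h1
    _ = ENNReal.ofReal n := by simp
    _ ≤ ENNReal.ofReal b := ENNReal.ofReal_le_ofReal hn

variable [IsProbabilityMeasure π] [IsMarkovKernel P]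

lemma le_spectralGap {φ : ℝ} (hφ0 : 0 < φ) (hrev : P.IsReversible π)
    (hφ : ∀ S, MeasurableSet S → π S ≤ 1 / 2 → ENNReal.ofReal φ * π S ≤ ∫⁻ x in S, P x Sᶜ ∂π) :
    ((φ ^ 2 / 2 : ℝ) : EReal) ≤ spectralGap π P := by
  refine le_iInf fun f => le_iInf fun hL => le_iInf fun hmean => le_iInf fun hne => ?_
  refine EReal.coe_le_coe_iff.2 ?_
  have hpos : 0 < ∫ x, f x ^ 2 ∂π :=
    lt_of_le_of_ne (integral_nonneg fun x => sq_nonneg _) (Ne.symm hne)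
  rw [le_div_iff₀ hpos]
  exact sq_mul_integral_sq_le hφ0 hrev hφ hL hmean

lemma mixingTime_le (hs : IsSymmOp P π) (hp : IsPosOp P π) {l : ℝ} (hl0 : 0 < l) (hl1 : l < 1)
    (hgap : ∀ f : X → ℝ, MemLp f 2 π → ∫ x, f x ∂π = 0 →
      l * ∫ x, f x ^ 2 ∂π ≤ ∫ x, f x * (f x - ∫ y, f y ∂(P x)) ∂π)
    (μ : Measure X) [IsProbabilityMeasure μ] {Ω ζ : ℝ} (hΩ : 0 < Ω) (hμ : IsWarmStart μ π Ω)
    (hζ : 0 < ζ) (hζΩ : ζ ≤ Real.sqrt Ω) :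
    (mixingTime μ π P ζ : ℝ≥0∞) ≤ ENNReal.ofReal (3 / l * Real.log (Real.sqrt Ω / ζ)) := by
  have hc : 0 < 1 - l := by linarith
  have hgap' : ∀ f : X → ℝ, BddMeasurable f → ∫ x, f x ∂π = 0 →
      ∫ x, f x * markovOp P f x ∂π ≤ (1 - l) * ∫ x, f x ^ 2 ∂π := by
    intro f hf hf0
    obtain ⟨B, hB⟩ := hf.bdd
    have h := hgap f (MemLp.of_bound hf.measurable.aestronglyMeasurable B
      (Filter.Eventually.of_forall fun x => by simpa using hB x)) hf0
    have e : ∫ x, f x * (f x - ∫ y, f y ∂(P x)) ∂π =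
        ∫ x, f x ^ 2 ∂π - ∫ x, f x * markovOp P f x ∂π := by
      simp_rw [sq]
      rw [← integral_sub ((hf.mul hf).integrable _) ((hf.mul (hf.markovOp P)).integrable _)]
      refine integral_congr_ae (Filter.Eventually.of_forall fun x => ?_)
      simp only [markovOp]
      ring
    rw [e] at h
    linarith
  have htv := tvDist_bind_pow_le hs hp hc hgap' μ hΩ hμ
  have hsq : 0 < Real.sqrt Ω := Real.sqrt_pos.2 hΩ
  have hL0 : 0 ≤ Real.log (Real.sqrt Ω / ζ) := Real.log_nonneg ((one_le_div hζ).2 hζΩ)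
  set L := Real.log (Real.sqrt Ω / ζ) with hL
  have hexpL : Real.exp L = Real.sqrt Ω / ζ := Real.exp_log (by positivity)
  -- The bound has no additive constant, so rounding up must be paid for by the logarithm. When the
  -- logarithm is small, zero steps already suffice, thanks to the factor `1 / 2` in
  -- `tvDist_bind_pow_le`.
  by_cases h2 : Real.sqrt Ω / 2 ≤ ζ
  · refine mixingTime_le_of_tvDist_le (n := 0) ((htv 0).trans (by simpa using h2)) ?_
    simpa using by positivity
  have hL2 : 1 / 2 ≤ L := by
    have h3 : (2 : ℝ) ≤ Real.sqrt Ω / ζ := by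
      rw [le_div_iff₀ hζ]
      linarith
    have := Real.log_le_log (by norm_num) h3
    linarith [Real.log_two_gt_d9]
  refine mixingTime_le_of_tvDist_le (n := ⌈L / l⌉₊) ((htv _).trans ?_) ?_
  · have hn : L ≤ l * ⌈L / l⌉₊ := by
      rw [← div_le_iff₀' hl0]
      exact Nat.le_ceil _
    have h4 : (1 - l) ^ ⌈L / l⌉₊ ≤ ζ / Real.sqrt Ω := by
      calc (1 - l) ^ ⌈L / l⌉₊ ≤ Real.exp (-l) ^ ⌈L / l⌉₊ :=
            pow_le_pow_left₀ hc.le (by linarith [Real.add_one_le_exp (-l)]) _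
        _ = Real.exp (-(l * ⌈L / l⌉₊)) := by rw [← Real.exp_nat_mul]; ring_nf
        _ ≤ Real.exp (-L) := Real.exp_le_exp.2 (neg_le_neg hn)
        _ = ζ / Real.sqrt Ω := by rw [Real.exp_neg, hexpL, inv_div]
    calc (1 - l) ^ ⌈L / l⌉₊ * (Real.sqrt Ω / 2) ≤ ζ / Real.sqrt Ω * (Real.sqrt Ω / 2) :=
          mul_le_mul_of_nonneg_right h4 (by positivity)
      _ = ζ / 2 := by field_simp
      _ ≤ ζ := by linarith
  · have h5 := (Nat.ceil_lt_add_one (div_nonneg hL0 hl0.le)).le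
    refine h5.trans ?_
    have h6 : 1 ≤ 2 * L / l := by
      rw [one_le_div hl0]
      linarith
    calc L / l + 1 ≤ L / l + 2 * L / l := by linarith
      _ = 3 / l * L := by ring

end Chains

/-- Fixes the length scale: at distance of order `(M N)^(-1/β)`, TV continuity gives a per-step
error of order `1 / N`. With `β ≤ 1` the numerical factor does not grow. -/
lemma mul_rpow_le_of_le {M N β x : ℝ} (hM : 0 < M) (hN : 0 < N) (hβ : 0 < β) (hβ1 : β ≤ 1)
    (hx0 : 0 ≤ x) (hx : x ≤ 17 / 16 * (2 * (M * N) ^ (-(1 / β)))) : M * x ^ β ≤ 17 / 8 / N := by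
  have hMN : 0 < M * N := mul_pos hM hN
  have h1 : x ^ β ≤ (17 / 8 * (M * N) ^ (-(1 / β))) ^ β :=
    Real.rpow_le_rpow hx0 (by linarith) hβ.le
  rw [Real.mul_rpow (by norm_num) (by positivity), ← Real.rpow_mul hMN.le,
    show -(1 / β) * β = -1 by field_simp, Real.rpow_neg_one] at h1
  have h2 : (17 / 8 : ℝ) ^ β ≤ 17 / 8 := by
    calc (17 / 8 : ℝ) ^ β ≤ (17 / 8 : ℝ) ^ (1 : ℝ) :=
          Real.rpow_le_rpow_of_exponent_le (by norm_num) hβ1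
      _ = 17 / 8 := Real.rpow_one _
  calc M * x ^ β ≤ M * (17 / 8 * (M * N)⁻¹) := by gcongr; exact h1.trans (by gcongr)
    _ = 17 / 8 / N := by field_simp

end GibbsSampler

/-! ### Assembling the estimates. -/

theorem mainTheorem3 :
    ∃ c₁ c₂ c₃ : ℝ, 0 < c₁ ∧ 0 < c₂ ∧ 0 < c₃ ∧
      ∀ (d : ℕ), 2 ≤ d →
      ∀ (π : Measure (EuclideanSpace ℝ (Fin d))) [IsProbabilityMeasure π]
        (κ : (k : Fin d) → Kernel (EuclideanSpace ℝ {j : Fin d // j ≠ k}) ℝ)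
        [∀ k, IsMarkovKernel (κ k)] (q C M β : ℝ),
        1 ≤ q → 0 < C → 0 < M → 0 < β → β ≤ 1 →
        GibbsSampler.IsFullConditional π κ →
        GibbsSampler.SatisfiesPoincare π q C →
        GibbsSampler.IsTVContinuous κ M β →
        ∀ N : ℕ, N = ⌈4 * (d : ℝ) * Real.log d⌉₊ →
          ENNReal.ofReal (c₁ * min 1 (C / (M * N) ^ (q / β))) ≤
              GibbsSampler.conductance π (GibbsSampler.randomScan κ ^ N) ∧
          ((c₂ * min 1 (C ^ 2 / (M * N) ^ (2 * q / β)) : ℝ) : EReal) ≤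
              GibbsSampler.spectralGap π (GibbsSampler.randomScan κ ^ N) ∧
          ∀ (μ : Measure (EuclideanSpace ℝ (Fin d))) [IsProbabilityMeasure μ] (Ω ζ : ℝ),
            0 < Ω → GibbsSampler.IsWarmStart μ π Ω → 0 < ζ → ζ ≤ Real.sqrt Ω →
            (GibbsSampler.mixingTime μ π (GibbsSampler.randomScan κ ^ N) ζ : ℝ≥0∞) ≤
              ENNReal.ofReal (c₃ * max 1 ((M * N) ^ (2 * q / β) / C ^ 2) *
                Real.log (Real.sqrt Ω / ζ)) := by
  -- Cheeger gives `(1 / 64)² / 2 = 1 / 8192`, and `24576 = 3 * 8192`.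
  refine ⟨1 / 64, 1 / 8192, 24576, by norm_num, by norm_num, by norm_num, ?_⟩
  intro d hd π _ κ _ q C M β hq hC hM hβ hβ1 hfull hpoin htv N hN
  have : NeZero d := ⟨by omega⟩
  have hN0 : (0 : ℝ) < N := by
    have hd' : (2 : ℝ) ≤ d := by exact_mod_cast hd
    have hlog : 0 < Real.log d := Real.log_pos (by linarith)
    rw [hN]
    exact_mod_cast Nat.ceil_pos.2 (by positivity)
  have hMN : 0 < M * N := mul_pos hM hN0
  -- The factor 2 cancels the halving in `C * (r / 2) ^ q`, so that no constant depending on `q`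
  -- remains.
  set r : ℝ := 2 * (M * N) ^ (-(1 / β)) with hr
  have hr0 : 0 < r := by positivity
  set K : ℝ := C / (M * N) ^ (q / β) with hK
  have hK0 : 0 < K := by positivity
  have hKr : C * (r / 2) ^ q = K := by
    rw [hr, mul_div_cancel_left₀ _ (by norm_num), ← Real.rpow_mul hMN.le,
      show -(1 / β) * q = -(q / β) by ring, Real.rpow_neg hMN.le, hK, div_eq_mul_inv C]
  have hK2 : C ^ 2 / (M * N) ^ (2 * q / β) = K ^ 2 := by
    rw [hK, div_pow, ← Real.rpow_natCast (_ ^ (q / β)), ← Real.rpow_mul hMN.le]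
    congr 2
    push_cast
    ring
  have hsymm := GibbsSampler.isSymmOp_randomScan hfull
  have hsN := hsymm.pow N
  have hpN := (GibbsSampler.isPosOp_randomScan hfull).pow hsymm N
  have hrev := hsN.isReversible
  have hcond : ∀ S, MeasurableSet S → π S ≤ 1 / 2 →
      ENNReal.ofReal (1 / 64 * min 1 K) * π S ≤
        ∫⁻ x in S, (GibbsSampler.randomScan κ ^ N) x Sᶜ ∂π := by
    intro S hS hS2
    rw [← hKr]
    -- The separating function needs `r < δ` strictly; the excess `1 / 16` is what the overlap
    -- estimate can afford.
    refine GibbsSampler.conductance_lower_bound hq hC hpoin hr0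
      (show r < 17 / 16 * r by linarith) hrev (fun T hT x y hxy => ?_) hS hS2
    have hI := GibbsSampler.bddMeasurable_indicator hT
    have := GibbsSampler.randomScan_pow_overlap hd κ hN (δ := 17 / 16 * r) (fun k x y hxy =>
      (htv k x y).trans (GibbsSampler.mul_rpow_le_of_le hM hN0 hβ hβ1 (norm_nonneg _)
        ((GibbsSampler.norm_dropCoord_sub_le k x y).trans hxy))) hI.measurable
      (fun x => Set.indicator_nonneg (fun _ _ => zero_le_one) x)
      (fun x => Set.indicator_le_self' (fun _ _ => zero_le_one) x)
      (show ‖x - y‖ ≤ 17 / 16 * r by rwa [← dist_eq_norm])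
    rwa [GibbsSampler.markovOp_indicator _ hT, GibbsSampler.markovOp_indicator _ hT] at this
  have hφ0 : 0 < 1 / 64 * min 1 K := by positivity
  have hgapval : (1 / 64 * min 1 K) ^ 2 / 2 = 1 / 8192 * min 1 (K ^ 2) := by
    rcases le_total 1 K with h | h
    · rw [min_eq_left h, min_eq_left (one_le_pow₀ h)]
      norm_num
    · rw [min_eq_right h, min_eq_right (pow_le_one₀ hK0.le h)]
      ring
  rw [hK2]
  refine ⟨GibbsSampler.le_conductance hcond, ?_, ?_⟩
  · rw [← hgapval]
    exact GibbsSampler.le_spectralGap hφ0 hrev hcond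
  · intro μ _ Ω ζ hΩ hμ hζ hζΩ
    have hm0 : 0 < min 1 (K ^ 2) := by positivity
    have hm1 : min 1 (K ^ 2) ≤ 1 := min_le_left _ _
    have hmax : max 1 ((M * N) ^ (2 * q / β) / C ^ 2) = (min 1 (K ^ 2))⁻¹ := by
      rw [← inv_div, hK2]
      rcases le_total 1 (K ^ 2) with h | h
      · rw [min_eq_left h, inv_one, max_eq_left (inv_le_one_of_one_le₀ h)]
      · rw [min_eq_right h, max_eq_right ((one_le_inv₀ (by positivity)).2 h)]
    have := GibbsSampler.mixingTime_le hsN hpN (l := 1 / 8192 * min 1 (K ^ 2)) (by positivity)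
      (by linarith) (fun f hL hmean => by
        rw [← hgapval]
        exact GibbsSampler.sq_mul_integral_sq_le hφ0 hrev hcond hL hmean) μ hΩ hμ hζ hζΩ
    rw [hmax]
    convert this using 3
    field_simp
    norm_num
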